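/- For each $n\ge 1$ let $p_n\in[0,1]$ and let $A=A_n=(a_{ij})_{1\le i,j\le n}$ be a random real symmetric matrix whose entries $(a_{ij})_{1\le i\le j\le n}$ are independent and Bernoulli distributed with parameter $p_n$ (that is, $a_{ij}=1$ with probability $p_n$ and $a_{ij}=0$ with probability $1-p_n$). Assume there is $\epsilon_0\in(0,1)$ such that, for all sufficiently large $n$, \[ n^{\epsilon_0-1}\le p_n\le \tfrac12 . \] Let $\lambda_1(A)$ denote the largest eigenvalue of $A$. Then $\lambda_1(A)$ is integrable and, as $n\to\infty$, \[ \frac{1}{\sqrt{p_n(1-p_n)}}\bigl(\lambda_1(A)-\mathbb{E}[\lambda_1(A)]\bigr)\Rightarrow N(0,2), \] where $\Rightarrow$ denotes convergence in distribution and $N(0,2)$ is the centered Gaussian law with variance $2$. -/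

import Mathlib

open MeasureTheory ProbabilityTheory Filter

/-- The largest eigenvalue `λ₁(M)` of a real symmetric matrix of size `n ≥ 1`, that is, the maximum
of its (finite, nonempty) spectrum; see `isGreatest_largestEigenvalue`. -/
noncomputable def largestEigenvalue {n : ℕ} (M : Matrix (Fin n) (Fin n) ℝ) : ℝ :=
  sSup (spectrum ℝ M)

theorem isGreatest_largestEigenvalue {n : ℕ} (hn : 0 < n) {M : Matrix (Fin n) (Fin n) ℝ}
    (hM : M.IsHermitian) : IsGreatest (spectrum ℝ M) (largestEigenvalue M) := by
  have : Nonempty (Fin n) := ⟨⟨0, hn⟩⟩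
  have h : spectrum ℝ M = Set.range hM.eigenvalues := hM.spectrum_real_eq_range_eigenvalues
  have hfin : (spectrum ℝ M).Finite := h ▸ Set.finite_range _
  have hne : (spectrum ℝ M).Nonempty := h ▸ Set.range_nonempty _
  exact ⟨hne.csSup_mem hfin, fun _ hx => le_csSup hfin.bddAbove hx⟩

/-- `A` is a random symmetric `n × n` matrix on `(Ω, P)` whose entries `a_ij`, `i ≤ j`, are
independent and Bernoulli distributed with parameter `q`: value `1` with probability `q` and
value `0` with probability `1 - q`. -/
structure IsSymmetricBernoulliMatrix {Ω : Type*} [MeasurableSpace Ω] (P : Measure Ω) {n : ℕ}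
    (q : unitInterval) (A : Ω → Matrix (Fin n) (Fin n) ℝ) : Prop where
  symm : ∀ ω, (A ω).IsSymm
  bernoulli : ∀ i j : Fin n, i ≤ j → HasLaw (fun ω => A ω i j) (bernoulliMeasure (1 : ℝ) 0 q) P
  indep : iIndepFun
    (fun (e : {e : Fin n × Fin n // e.1 ≤ e.2}) (ω : Ω) => A ω e.1.1 e.1.2) P

/-!
Let `L` be the mean of the row sums of `A`, so that `L ≤ λ₁(A)` by the Rayleigh principle. It is
a sum of independent variables which become negligible after division by `√(q (1 - q))`, where
`q = p n`, and its normalised variance is `2 - 1 / n`, so its fluctuations are Gaussian. It remains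
to see that `D = λ₁(A) - L` has variance `o(q (1 - q))`.

Flipping the entry `(i, j)` changes `λ₁` by an amount lying between the values of `vᵢ vⱼ` (doubled
if `i ≠ j`) for the top unit eigenvectors `v` before and after the flip. With the Efron–Stein
inequality and `L ≤ λ₁(A)`, the variance of `D` is therefore at most twice the mean of
`(1 - 2 q) ⟨v², H v²⟩ + (2 / n) ⟨v, H v⟩`, where `v²` is taken entrywise and `H` is the centered
matrix. Let `δ⁴ = n q (1 - q)`. Up to a negligible event, controlled by the Frobenius norm of a high
power of `H`, the norm of `H` is at most `δ³`, and the quantity is then at most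
`δ³ (∑ vᵢ⁴ + 2 / n)`.

Finally `∑ vᵢ⁴ = O(1 / n)` in the mean: iterating `λ₁ v = q ⟨v, 1⟩ 1 + H v` expresses `v` through
the vectors `Hᵏ 1`, whose entries have moments that are bounded by counting walks in which every
edge is used at least twice. Hence the variance of `D` is `O(δ³ / n) = O(q (1 - q) / δ)`.
-/

section Pi

variable {X : Type*} [MeasurableSpace X]

theorem measurePreserving_finCons {n : ℕ} (μ : Fin (n + 1) → Measure X) [∀ i, SigmaFinite (μ i)] :
    MeasurePreserving (fun z : X × (Fin n → X) => (Fin.cons z.1 z.2 : Fin (n + 1) → X))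
      ((μ 0).prod (Measure.pi fun i => μ i.succ)) (Measure.pi μ) := by
  have h := (measurePreserving_piFinSuccAbove μ 0).symm
  have hcons : ⇑(MeasurableEquiv.piFinSuccAbove (fun _ => X) (0 : Fin (n + 1))).symm
      = fun z : X × (Fin n → X) => (Fin.cons z.1 z.2 : Fin (n + 1) → X) := by
    funext z
    simp [MeasurableEquiv.piFinSuccAbove, Fin.insertNthEquiv]
  rwa [hcons] at h

theorem measurePreserving_update {ι : Type*} [Fintype ι] [DecidableEq ι] (μ : ι → Measure X)
    [∀ i, IsProbabilityMeasure (μ i)] (i : ι) :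
    MeasurePreserving (fun z : (ι → X) × X => Function.update z.1 i z.2)
      ((Measure.pi μ).prod (μ i)) (Measure.pi μ) := by
  have hmeas : Measurable fun z : (ι → X) × X => Function.update z.1 i z.2 := measurable_update'
  refine ⟨hmeas, (Measure.pi_eq fun s hs => ?_).symm⟩
  have hpreimage : (fun z : (ι → X) × X => Function.update z.1 i z.2) ⁻¹' Set.univ.pi s
      = (Set.univ.pi (Function.update s i Set.univ)) ×ˢ s i := by
    ext z
    simp only [Set.mem_preimage, Set.mem_pi, Set.mem_univ, Function.update_apply, Set.mem_prod]
    grind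
  rw [Measure.map_apply hmeas (.univ_pi hs), hpreimage, Measure.prod_prod, Measure.pi_pi,
    ← Finset.prod_erase_mul _ _ (Finset.mem_univ i), Function.update_self, measure_univ, mul_one,
    ← Finset.prod_erase_mul _ _ (Finset.mem_univ i)]
  congr 1
  exact Finset.prod_congr rfl fun j hj => by rw [Function.update_of_ne (Finset.ne_of_mem_erase hj)]

end Pi

section EfronStein

variable {X Y : Type*} [Finite X] [MeasurableSpace X] [DiscreteMeasurableSpace X]
  [Finite Y] [MeasurableSpace Y] [DiscreteMeasurableSpace Y]

theorem variance_integral_prod_le (μ : Measure X) (ν : Measure Y) [IsProbabilityMeasure μ]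
    [IsProbabilityMeasure ν] (f : X × Y → ℝ) :
    Var[fun x => ∫ y, f (x, y) ∂ν; μ] ≤ ∫ y, Var[fun x => f (x, y); μ] ∂ν := by
  have hmean : ∫ x, ∫ y, f (x, y) ∂ν ∂μ = ∫ y, ∫ x, f (x, y) ∂μ ∂ν :=
    integral_integral_swap .of_finite
  have hjensen (x : X) : (∫ y, f (x, y) ∂ν - ∫ y, ∫ x', f (x', y) ∂μ ∂ν) ^ 2
      ≤ ∫ y, (f (x, y) - ∫ x', f (x', y) ∂μ) ^ 2 ∂ν := by
    rw [← integral_sub .of_finite .of_finite]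
    have hvar := variance_nonneg (fun y => f (x, y) - ∫ x', f (x', y) ∂μ) ν
    rwa [variance_eq_sub .of_discrete, sub_nonneg] at hvar
  calc Var[fun x => ∫ y, f (x, y) ∂ν; μ]
      = ∫ x, (∫ y, f (x, y) ∂ν - ∫ y, ∫ x', f (x', y) ∂μ ∂ν) ^ 2 ∂μ := by
        rw [variance_eq_integral (Measurable.of_discrete).aemeasurable, hmean]
    _ ≤ ∫ x, ∫ y, (f (x, y) - ∫ x', f (x', y) ∂μ) ^ 2 ∂ν ∂μ :=
        integral_mono .of_finite .of_finite hjensen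
    _ = ∫ y, ∫ x, (f (x, y) - ∫ x', f (x', y) ∂μ) ^ 2 ∂μ ∂ν :=
        integral_integral_swap .of_finite
    _ = ∫ y, Var[fun x => f (x, y); μ] ∂ν := by
        simp_rw [variance_eq_integral (Measurable.of_discrete).aemeasurable]

theorem variance_prod_le (μ : Measure X) (ν : Measure Y) [IsProbabilityMeasure μ]
    [IsProbabilityMeasure ν] (f : X × Y → ℝ) :
    Var[f; μ.prod ν] ≤ ∫ x, Var[fun y => f (x, y); ν] ∂μ + ∫ y, Var[fun x => f (x, y); μ] ∂ν := by
  refine le_trans (le_of_eq ?_) (add_le_add_right (variance_integral_prod_le μ ν f) _)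
  have hν (x : X) : Var[fun y => f (x, y); ν] = ∫ y, f (x, y) ^ 2 ∂ν - (∫ y, f (x, y) ∂ν) ^ 2 :=
    variance_eq_sub .of_discrete
  simp_rw [hν]
  rw [variance_eq_sub .of_discrete, variance_eq_sub .of_discrete,
    integral_sub .of_finite .of_finite]
  simp only [Pi.pow_apply]
  rw [integral_prod _ .of_finite, integral_prod _ .of_finite]
  ring

theorem variance_pi_fin_le_sum {n : ℕ} (μ : Fin n → Measure X) [∀ i, IsProbabilityMeasure (μ i)]
    (f : (Fin n → X) → ℝ) :
    Var[f; Measure.pi μ]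
      ≤ ∑ i, ∫ x, Var[fun a => f (Function.update x i a); μ i] ∂Measure.pi μ := by
  induction n with
  | zero =>
    have hconst : f = fun _ => f default := funext fun x => by rw [Subsingleton.elim x default]
    rw [hconst, variance_eq_integral (Measurable.of_discrete).aemeasurable]
    simp
  | succ n ih =>
    let ν := Measure.pi fun i : Fin n => μ i.succ
    have hcons := measurePreserving_finCons μ
    have hintegral (g : (Fin (n + 1) → X) → ℝ) :
        ∫ x, g x ∂Measure.pi μ = ∫ a, ∫ x, g (Fin.cons a x) ∂ν ∂μ 0 := by
      rw [← hcons.map_eq, integral_map hcons.aemeasurable .of_discrete, integral_prod _ .of_finite]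
    calc Var[f; Measure.pi μ]
        = Var[fun z : X × (Fin n → X) => f (Fin.cons z.1 z.2); (μ 0).prod ν] :=
          (hcons.variance_fun_comp (Measurable.of_discrete).aemeasurable).symm
      _ ≤ ∫ a, Var[fun x => f (Fin.cons a x); ν] ∂μ 0
          + ∫ x, Var[fun a => f (Fin.cons a x); μ 0] ∂ν := variance_prod_le _ _ _
      _ ≤ ∫ a, ∑ i : Fin n, ∫ x, Var[fun b => f (Fin.cons a (Function.update x i b)); μ i.succ] ∂ν
            ∂μ 0 + ∫ x, Var[fun a => f (Fin.cons a x); μ 0] ∂ν := by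
          refine add_le_add_left (integral_mono .of_finite .of_finite fun a => ?_) _
          exact ih (fun i => μ i.succ) _
      _ = ∑ i, ∫ x, Var[fun a => f (Function.update x i a); μ i] ∂Measure.pi μ := by
          rw [integral_finsetSum (μ := μ 0) _ fun _ _ => .of_finite, Fin.sum_univ_succ, add_comm]
          simp [hintegral, ← Fin.cons_update]

/-- The **Efron–Stein inequality**. -/
theorem variance_pi_le_sum {ι : Type*} [Fintype ι] [DecidableEq ι] (μ : ι → Measure X)
    [∀ i, IsProbabilityMeasure (μ i)] (f : (ι → X) → ℝ) :
    Var[f; Measure.pi μ]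
      ≤ ∑ i, ∫ x, Var[fun a => f (Function.update x i a); μ i] ∂Measure.pi μ := by
  let e := (Fintype.equivFin ι).symm
  let reindex : (Fin (Fintype.card ι) → X) → ι → X := fun x => x ∘ e.symm
  have hreindex : MeasurePreserving reindex (Measure.pi fun k => μ (e k)) (Measure.pi μ) := by
    have h := measurePreserving_piCongrLeft μ e
    have he : ⇑(MeasurableEquiv.piCongrLeft (fun _ => X) e) = reindex :=
      funext fun x => funext fun i => by
        simp [reindex, MeasurableEquiv.coe_piCongrLeft, Equiv.piCongrLeft_apply]
    rwa [he] at h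
  have hupdate (x : Fin (Fintype.card ι) → X) (k : Fin (Fintype.card ι)) (a : X) :
      reindex (Function.update x k a) = Function.update (reindex x) (e k) a := by
    simp [reindex, Function.update_comp_equiv]
  rw [← hreindex.variance_fun_comp (Measurable.of_discrete).aemeasurable, ← e.sum_comp]
  refine (variance_pi_fin_le_sum _ _).trans_eq (Finset.sum_congr rfl fun k _ => ?_)
  rw [← hreindex.map_eq, integral_map hreindex.aemeasurable .of_discrete]
  simp_rw [hupdate]

theorem integral_pi_update {ι : Type*} [Fintype ι] [DecidableEq ι] (μ : ι → Measure X)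
    [∀ i, IsProbabilityMeasure (μ i)] (i : ι) (f : (ι → X) → ℝ) :
    ∫ x, ∫ a, f (Function.update x i a) ∂μ i ∂Measure.pi μ = ∫ x, f x ∂Measure.pi μ := by
  have hupdate := measurePreserving_update μ i
  nth_rewrite 2 [← hupdate.map_eq]
  rw [integral_map hupdate.aemeasurable .of_discrete, integral_prod _ .of_finite]
end EfronStein

section Cube

/-- The law of a family of independent Bernoulli variables of parameter `q` indexed by `ι`, on the
discrete cube `ι → Bool`. -/
noncomputable abbrev cubeMeasure (ι : Type*) [Fintype ι] (q : unitInterval) :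
    Measure (ι → Bool) :=
  Measure.pi fun _ => bernoulliMeasure true false q

theorem mul_one_sub_nonneg (q : unitInterval) : 0 ≤ (q * (1 - q) : ℝ) :=
  mul_nonneg q.2.1 (sub_nonneg.2 q.2.2)

theorem variance_bernoulliMeasure_bool (q : unitInterval) (g : Bool → ℝ) :
    Var[g; bernoulliMeasure true false q] = q * (1 - q) * (g true - g false) ^ 2 := by
  rw [variance_eq_sub .of_discrete]
  simp only [integral_bernoulliMeasure, Pi.pow_apply, smul_eq_mul]
  ring

variable {ι : Type*} [Fintype ι]

theorem integral_cubeMeasure_update [DecidableEq ι] (q : unitInterval) (i : ι)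
    (f : (ι → Bool) → ℝ) :
    ∫ x, f x ∂cubeMeasure ι q = q * ∫ x, f (Function.update x i true) ∂cubeMeasure ι q
      + (1 - q) * ∫ x, f (Function.update x i false) ∂cubeMeasure ι q := by
  rw [← integral_pi_update _ i f, ← integral_const_mul, ← integral_const_mul,
    ← integral_add .of_finite .of_finite]
  simp [integral_bernoulliMeasure]

theorem variance_cubeMeasure_le_sum [DecidableEq ι] (q : unitInterval) (f : (ι → Bool) → ℝ)
    (g : ι → (ι → Bool) → ℝ)
    (hfg : ∀ i x, (f (Function.update x i true) - f (Function.update x i false)) ^ 2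
      ≤ g i (Function.update x i true) + g i (Function.update x i false)) :
    Var[f; cubeMeasure ι q]
      ≤ ∑ i, ∫ x, (if x i then 1 - q else q : ℝ) * g i x ∂cubeMeasure ι q := by
  refine (variance_pi_le_sum _ f).trans (Finset.sum_le_sum fun i _ => ?_)
  have hq : 0 ≤ (q * (1 - q) : ℝ) := mul_one_sub_nonneg q
  calc ∫ x, Var[fun a => f (Function.update x i a); bernoulliMeasure true false q] ∂cubeMeasure ι q
      ≤ ∫ x, q * (1 - q) * (g i (Function.update x i true) + g i (Function.update x i false))
          ∂cubeMeasure ι q := by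
        refine integral_mono .of_finite .of_finite fun x => ?_
        simp only [variance_bernoulliMeasure_bool]
        exact mul_le_mul_of_nonneg_left (hfg i x) hq
    _ = ∫ x, (if x i then 1 - q else q : ℝ) * g i x ∂cubeMeasure ι q := by
        rw [integral_cubeMeasure_update q i fun x => (if x i then 1 - q else q : ℝ) * g i x,
          integral_const_mul, integral_add .of_finite .of_finite]
        simp only [Function.update_self, if_true, Bool.false_eq_true, if_false, integral_const_mul]
        ring

/-- A centered Bernoulli variable of parameter `q`, as a function of its underlying bit. -/
noncomputable def centeredBit (q : unitInterval) (b : Bool) : ℝ := (if b then 1 else 0) - q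

theorem abs_centeredBit_le_one (q : unitInterval) (b : Bool) : |centeredBit q b| ≤ 1 := by
  have hq := q.2
  rw [abs_le]
  cases b <;> constructor <;> simp [centeredBit] <;> linarith [hq.1, hq.2]

theorem integral_centeredBit (q : unitInterval) :
    ∫ b, centeredBit q b ∂bernoulliMeasure true false q = 0 := by
  simp [integral_bernoulliMeasure, centeredBit]
  ring

theorem integral_centeredBit_eval (q : unitInterval) (i : ι) :
    ∫ x, centeredBit q (x i) ∂cubeMeasure ι q = 0 :=
  (integral_comp_eval (μ := fun _ : ι => bernoulliMeasure true false q) (f := centeredBit q)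
    .of_discrete).trans (integral_centeredBit q)

theorem abs_integral_centeredBit_pow_le (q : unitInterval) {m : ℕ} (hm : 2 ≤ m) :
    |∫ b, centeredBit q b ^ m ∂bernoulliMeasure true false q| ≤ q * (1 - q) := by
  have hsq (b : Bool) : |centeredBit q b ^ m| ≤ centeredBit q b ^ 2 := by
    rw [abs_pow, ← sq_abs (centeredBit q b)]
    exact pow_le_pow_of_le_one (abs_nonneg _) (abs_centeredBit_le_one q b) hm
  calc |∫ b, centeredBit q b ^ m ∂bernoulliMeasure true false q|
      ≤ ∫ b, |centeredBit q b ^ m| ∂bernoulliMeasure true false q := abs_integral_le_integral_abs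
    _ ≤ ∫ b, centeredBit q b ^ 2 ∂bernoulliMeasure true false q :=
        integral_mono .of_finite .of_finite hsq
    _ = q * (1 - q) := by
        simp [integral_bernoulliMeasure, centeredBit]
        ring

/-- Each bit must occur at least twice for the product to have a nonzero mean, and every distinct
bit then contributes a factor of at most its variance. -/
theorem abs_integral_prod_centeredBit_le [DecidableEq ι] {τ : Type*} [Fintype τ] (q : unitInterval)
    (g : τ → ι) :
    |∫ x, ∏ t, centeredBit q (x (g t)) ∂cubeMeasure ι q| ≤
      if 2 * (Finset.univ.image g).card ≤ Fintype.card τ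
        then (q * (1 - q) : ℝ) ^ (Finset.univ.image g).card else 0 := by
  have hq : 0 ≤ (q * (1 - q) : ℝ) := mul_one_sub_nonneg q
  let mult (i : ι) : ℕ := (Finset.univ.filter fun t => g t = i).card
  have hprod (x : ι → Bool) : ∏ t, centeredBit q (x (g t)) = ∏ i, centeredBit q (x i) ^ mult i := by
    rw [← Finset.prod_fiberwise Finset.univ g]
    refine Finset.prod_congr rfl fun i _ => ?_
    rw [← Finset.prod_const]
    exact Finset.prod_congr rfl fun t ht => by rw [(Finset.mem_filter.1 ht).2]
  simp_rw [hprod]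
  rw [integral_fintype_prod_eq_prod (fun i b => centeredBit q b ^ mult i)]
  have hmem (i : ι) : i ∈ Finset.univ.image g ↔ mult i ≠ 0 := by
    simp [mult, Finset.filter_eq_empty_iff]
  by_cases hsingle : ∃ i, mult i = 1
  · obtain ⟨i, hi⟩ := hsingle
    rw [Finset.prod_eq_zero (Finset.mem_univ i) (by simp [hi, integral_centeredBit]), abs_zero]
    split_ifs <;> positivity
  · push Not at hsingle
    have htwo (i : ι) (hi : i ∈ Finset.univ.image g) : 2 ≤ mult i := by
      have := (hmem i).1 hi
      have := hsingle i
      omega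
    have hcard : 2 * (Finset.univ.image g).card ≤ Fintype.card τ := by
      rw [← Finset.card_univ, Finset.card_eq_sum_card_image g Finset.univ, mul_comm, ← smul_eq_mul]
      exact Finset.card_nsmul_le_sum _ _ _ htwo
    have hfactor (i : ι) : |∫ b, centeredBit q b ^ mult i ∂bernoulliMeasure true false q|
        ≤ if i ∈ Finset.univ.image g then (q * (1 - q) : ℝ) else 1 := by
      split_ifs with hi
      · exact abs_integral_centeredBit_pow_le q (htwo i hi)
      · simp [not_not.1 (mt (hmem i).2 hi)]
    rw [if_pos hcard, Finset.abs_prod]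
    calc ∏ i, |∫ b, centeredBit q b ^ mult i ∂bernoulliMeasure true false q|
        ≤ ∏ i, if i ∈ Finset.univ.image g then (q * (1 - q) : ℝ) else 1 :=
          Finset.prod_le_prod (fun _ _ => abs_nonneg _) fun i _ => hfactor i
      _ = (q * (1 - q) : ℝ) ^ (Finset.univ.image g).card := by
          rw [Finset.prod_ite_mem_eq, Finset.prod_const]

end Cube

section LinearAlgebra

open Matrix
open scoped Matrix.Norms.L2Operator

variable {V : Type*} [Fintype V]

theorem dotProduct_sq_le (u v : V → ℝ) : (u ⬝ᵥ v) ^ 2 ≤ (u ⬝ᵥ u) * (v ⬝ᵥ v) := by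
  simpa only [dotProduct, ← sq] using Finset.sum_mul_sq_le_sq_mul_sq Finset.univ u v

theorem sq_sum_le_card_mul_dotProduct_self (u : V → ℝ) :
    (∑ i, u i) ^ 2 ≤ Fintype.card V * (u ⬝ᵥ u) := by
  have h := dotProduct_sq_le u 1
  rwa [one_dotProduct_one, dotProduct_one, mul_comm] at h

theorem sum_pow_four_le_dotProduct_self_sq (u : V → ℝ) : ∑ i, u i ^ 4 ≤ (u ⬝ᵥ u) ^ 2 := by
  calc ∑ i, u i ^ 4 = ∑ i, (u i ^ 2) ^ 2 := by simp only [← pow_mul, Nat.reduceMul]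
    _ ≤ (∑ i, u i ^ 2) ^ 2 := Finset.sum_sq_le_sq_sum_of_nonneg fun i _ => sq_nonneg _
    _ = (u ⬝ᵥ u) ^ 2 := by simp only [dotProduct, ← sq]

theorem dotProduct_mulVec_eq_sum (M : Matrix V V ℝ) (u : V → ℝ) :
    u ⬝ᵥ M *ᵥ u = ∑ i, ∑ j, M i j * (u i * u j) := by
  simp only [dotProduct, mulVec, Finset.mul_sum]
  exact Finset.sum_congr rfl fun i _ => Finset.sum_congr rfl fun j _ => by ring

theorem dotProduct_const_mulVec (c : ℝ) (u : V → ℝ) :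
    u ⬝ᵥ (Matrix.of fun _ _ => c) *ᵥ u = c * (∑ i, u i) ^ 2 := by
  rw [dotProduct_mulVec_eq_sum, sq, Finset.sum_mul_sum, Finset.mul_sum]
  simp only [Matrix.of_apply, Finset.mul_sum]

theorem sum_mul_mul_sub_sq (M : Matrix V V ℝ) (v : V → ℝ) (c : ℝ) :
    ∑ i, ∑ j, M i j * (v i * v j - c) ^ 2
      = v ^ 2 ⬝ᵥ M *ᵥ v ^ 2 - 2 * c * (v ⬝ᵥ M *ᵥ v) + c ^ 2 * (1 ⬝ᵥ M *ᵥ 1) := by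
  simp only [dotProduct_mulVec_eq_sum, Finset.mul_sum, ← Finset.sum_sub_distrib,
    ← Finset.sum_add_distrib, Pi.pow_apply, Pi.one_apply]
  exact Finset.sum_congr rfl fun i _ => Finset.sum_congr rfl fun j _ => by ring

theorem abs_dotProduct_mulVec_le_sq_sum_abs {B : Matrix V V ℝ} (hB : ∀ i j, |B i j| ≤ 1)
    (u : V → ℝ) : |u ⬝ᵥ B *ᵥ u| ≤ (∑ i, |u i|) ^ 2 := by
  rw [dotProduct_mulVec_eq_sum, sq, Finset.sum_mul_sum]
  refine (Finset.abs_sum_le_sum_abs _ _).trans (Finset.sum_le_sum fun i _ => ?_)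
  refine (Finset.abs_sum_le_sum_abs _ _).trans (Finset.sum_le_sum fun j _ => ?_)
  rw [abs_mul, abs_mul]
  exact mul_le_of_le_one_left (by positivity) (hB i j)

theorem dotProduct_self_eq_norm_sq (u : V → ℝ) : u ⬝ᵥ u = ‖WithLp.toLp 2 u‖ ^ 2 := by
  rw [EuclideanSpace.real_norm_sq_eq]
  simp only [dotProduct, sq]

variable [DecidableEq V]

theorem mulVec_dotProduct_mulVec_le (B : Matrix V V ℝ) (u : V → ℝ) :
    B *ᵥ u ⬝ᵥ B *ᵥ u ≤ ‖B‖ ^ 2 * (u ⬝ᵥ u) := by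
  rw [dotProduct_self_eq_norm_sq, dotProduct_self_eq_norm_sq, ← mul_pow]
  exact pow_le_pow_left₀ (norm_nonneg _) (l2_opNorm_mulVec B (WithLp.toLp 2 u)) 2

theorem abs_dotProduct_mulVec_le (B : Matrix V V ℝ) (u : V → ℝ) :
    |u ⬝ᵥ B *ᵥ u| ≤ ‖B‖ * (u ⬝ᵥ u) := by
  have hu : 0 ≤ u ⬝ᵥ u := dotProduct_self_star_nonneg u
  refine abs_le_of_sq_le_sq ?_ (by positivity)
  calc (u ⬝ᵥ B *ᵥ u) ^ 2 ≤ (u ⬝ᵥ u) * (B *ᵥ u ⬝ᵥ B *ᵥ u) := dotProduct_sq_le _ _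
    _ ≤ (u ⬝ᵥ u) * (‖B‖ ^ 2 * (u ⬝ᵥ u)) := by gcongr; exact mulVec_dotProduct_mulVec_le B u
    _ = (‖B‖ * (u ⬝ᵥ u)) ^ 2 := by ring

theorem l2_opNorm_sq_le_sum_sq (B : Matrix V V ℝ) : ‖B‖ ^ 2 ≤ ∑ i, ∑ j, B i j ^ 2 := by
  have hF : 0 ≤ ∑ i, ∑ j, B i j ^ 2 := by positivity
  rw [← Real.le_sqrt (norm_nonneg _) hF, l2_opNorm_def]
  refine ContinuousLinearMap.opNorm_le_bound _ (Real.sqrt_nonneg _) fun u => ?_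
  refine le_of_sq_le_sq ?_ (by positivity)
  rw [mul_pow, Real.sq_sqrt hF, EuclideanSpace.real_norm_sq_eq, EuclideanSpace.real_norm_sq_eq,
    Finset.sum_mul]
  exact Finset.sum_le_sum fun i _ => Finset.sum_mul_sq_le_sq_mul_sq _ (B i) u

theorem l2_opNorm_pow_le_sum_sq {B : Matrix V V ℝ} (hB : B.IsHermitian) (m : ℕ) :
    (‖B‖ ^ 2) ^ 2 ^ m ≤ ∑ i, ∑ j, (B ^ 2 ^ m) i j ^ 2 := by
  rw [pow_right_comm, ← IsSelfAdjoint.norm_pow_two_pow hB m]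
  exact l2_opNorm_sq_le_sum_sq _

theorem eigenvector_expansion {H : Matrix V V ℝ} {u v : V → ℝ} {l a : ℝ} (hl : l ≠ 0)
    (hv : l • v = a • u + H *ᵥ v) (N : ℕ) :
    v = ∑ k ∈ Finset.range N, (a / l ^ (k + 1)) • (H ^ k *ᵥ u) + (l ^ N)⁻¹ • (H ^ N *ᵥ v) := by
  induction N with
  | zero => simp
  | succ N ih =>
    have hstep : H ^ N *ᵥ v = l⁻¹ • (a • (H ^ N *ᵥ u) + H ^ (N + 1) *ᵥ v) := by
      rw [pow_succ, ← mulVec_mulVec, ← mulVec_smul, ← mulVec_add, ← hv, mulVec_smul,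
        inv_smul_smul₀ hl]
    rw [Finset.sum_range_succ, add_assoc]
    nth_rewrite 1 [ih]
    rw [hstep]
    congr 1
    simp only [smul_add, smul_smul, pow_succ, mul_inv]
    congr 2
    field_simp

theorem pow_four_sum_le {ι : Type*} (s : Finset ι) (a : ι → ℝ) :
    (∑ k ∈ s, a k) ^ 4 ≤ (s.card : ℝ) ^ 3 * ∑ k ∈ s, a k ^ 4 := by
  calc (∑ k ∈ s, a k) ^ 4 = ((∑ k ∈ s, a k) ^ 2) ^ 2 := by ring
    _ ≤ (s.card * ∑ k ∈ s, a k ^ 2) ^ 2 :=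
        pow_le_pow_left₀ (sq_nonneg _) sq_sum_le_card_mul_sum_sq 2
    _ = (s.card : ℝ) ^ 2 * (∑ k ∈ s, a k ^ 2) ^ 2 := mul_pow _ _ _
    _ ≤ (s.card : ℝ) ^ 2 * (s.card * ∑ k ∈ s, (a k ^ 2) ^ 2) := by
        gcongr
        exact sq_sum_le_card_mul_sum_sq
    _ = (s.card : ℝ) ^ 3 * ∑ k ∈ s, a k ^ 4 := by
        simp only [← pow_mul]
        ring

theorem sum_pow_four_eigenvector_le {H : Matrix V V ℝ} {u v : V → ℝ} {l a : ℝ} (hl : l ≠ 0)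
    (hv : l • v = a • u + H *ᵥ v) (hunit : v ⬝ᵥ v = 1) (N : ℕ) :
    ∑ i, v i ^ 4 ≤ 8 * ((N : ℝ) ^ 3 * ∑ k ∈ Finset.range N,
      (a / l ^ (k + 1)) ^ 4 * ∑ i, (H ^ k *ᵥ u) i ^ 4 + (‖H‖ / l) ^ (4 * N)) := by
  have hremainder : ∑ i, ((l ^ N)⁻¹ * (H ^ N *ᵥ v) i) ^ 4 ≤ (‖H‖ / l) ^ (4 * N) := by
    have hnorm : H ^ N *ᵥ v ⬝ᵥ H ^ N *ᵥ v ≤ (‖H‖ ^ N) ^ 2 := by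
      refine (mulVec_dotProduct_mulVec_le _ v).trans ?_
      rw [hunit, mul_one]
      have : Nonempty V := not_isEmpty_iff.1 fun h => by simp at hunit
      exact pow_le_pow_left₀ (norm_nonneg _) (norm_pow_le H N) 2
    calc ∑ i, ((l ^ N)⁻¹ * (H ^ N *ᵥ v) i) ^ 4
        = ((l ^ N)⁻¹) ^ 4 * ∑ i, (H ^ N *ᵥ v) i ^ 4 := by simp only [mul_pow, Finset.mul_sum]
      _ ≤ ((l ^ N)⁻¹) ^ 4 * ((‖H‖ ^ N) ^ 2) ^ 2 := by
          gcongr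
          exact (sum_pow_four_le_dotProduct_self_sq _).trans
            (pow_le_pow_left₀ (dotProduct_self_star_nonneg _) hnorm 2)
      _ = (‖H‖ / l) ^ (4 * N) := by
          rw [div_pow, div_eq_inv_mul, mul_comm 4, pow_mul l, inv_pow]
          ring
  calc ∑ i, v i ^ 4
      ≤ ∑ i, 8 * ((N : ℝ) ^ 3 * ∑ k ∈ Finset.range N,
          (a / l ^ (k + 1)) ^ 4 * (H ^ k *ᵥ u) i ^ 4 + ((l ^ N)⁻¹ * (H ^ N *ᵥ v) i) ^ 4) := by
        refine Finset.sum_le_sum fun i _ => ?_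
        have hi := congrFun (eigenvector_expansion hl hv N) i
        simp only [Pi.add_apply, Finset.sum_apply, Pi.smul_apply, smul_eq_mul] at hi
        have hsum := pow_four_sum_le (Finset.range N) fun k =>
          a / l ^ (k + 1) * (H ^ k *ᵥ u) i
        simp only [Finset.card_range, mul_pow (a / _)] at hsum
        rw [hi]
        refine (Even.add_pow_le (by decide)).trans ?_
        norm_num
        gcongr
    _ = 8 * ((N : ℝ) ^ 3 * ∑ k ∈ Finset.range N, (a / l ^ (k + 1)) ^ 4 *
          ∑ i, (H ^ k *ᵥ u) i ^ 4 + ∑ i, ((l ^ N)⁻¹ * (H ^ N *ᵥ v) i) ^ 4) := by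
        simp only [← Finset.mul_sum, Finset.sum_add_distrib]
        rw [Finset.sum_comm]
        simp only [← Finset.mul_sum]
    _ ≤ _ := by gcongr

end LinearAlgebra

section LargestEigenvalue

open Matrix

variable {n : ℕ} {M : Matrix (Fin n) (Fin n) ℝ}

theorem dotProduct_mulVec_le_largestEigenvalue (hn : 0 < n) (hM : M.IsHermitian)
    (u : Fin n → ℝ) : u ⬝ᵥ M *ᵥ u ≤ largestEigenvalue M * (u ⬝ᵥ u) := by
  have hB : (algebraMap ℝ (Matrix (Fin n) (Fin n) ℝ) (largestEigenvalue M) - M).IsHermitian :=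
    IsSelfAdjoint.sub (.algebraMap _ (.all _)) hM
  have hpos : (algebraMap ℝ (Matrix (Fin n) (Fin n) ℝ) (largestEigenvalue M) - M).PosSemidef := by
    refine hB.posSemidef_iff_eigenvalues_nonneg.2 fun i => ?_
    have hi := hB.eigenvalues_mem_spectrum_real i
    rw [← spectrum.singleton_sub_eq, Set.singleton_sub] at hi
    obtain ⟨b, hb, hi⟩ := hi
    exact (sub_nonneg.2 ((isGreatest_largestEigenvalue hn hM).2 hb)).trans_eq hi
  have h := hpos.dotProduct_mulVec_nonneg u
  simpa [sub_mulVec, Algebra.algebraMap_eq_smul_one, smul_mulVec] using h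

theorem exists_unit_eigenvector (hn : 0 < n) (hM : M.IsHermitian) :
    ∃ v : Fin n → ℝ, v ⬝ᵥ v = 1 ∧ M *ᵥ v = largestEigenvalue M • v := by
  obtain ⟨i, hi⟩ := hM.spectrum_real_eq_range_eigenvalues ▸ (isGreatest_largestEigenvalue hn hM).1
  refine ⟨hM.eigenvectorBasis i, ?_, hi ▸ hM.mulVec_eigenvectorBasis i⟩
  have h := EuclideanSpace.real_norm_sq_eq (hM.eigenvectorBasis i)
  rw [hM.eigenvectorBasis.norm_eq_one, one_pow] at h
  simp only [dotProduct, ← sq, ← h]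

/-- A unit eigenvector of `M` for its largest eigenvalue; an arbitrary vector if there is none. -/
noncomputable def topVec (M : Matrix (Fin n) (Fin n) ℝ) : Fin n → ℝ :=
  Classical.epsilon fun v => v ⬝ᵥ v = 1 ∧ M *ᵥ v = largestEigenvalue M • v

theorem topVec_dotProduct_self (hn : 0 < n) (hM : M.IsHermitian) : topVec M ⬝ᵥ topVec M = 1 :=
  (Classical.epsilon_spec (exists_unit_eigenvector hn hM)).1

theorem mulVec_topVec (hn : 0 < n) (hM : M.IsHermitian) :
    M *ᵥ topVec M = largestEigenvalue M • topVec M :=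
  (Classical.epsilon_spec (exists_unit_eigenvector hn hM)).2

theorem topVec_dotProduct_mulVec_topVec (hn : 0 < n) (hM : M.IsHermitian) :
    topVec M ⬝ᵥ M *ᵥ topVec M = largestEigenvalue M := by
  rw [mulVec_topVec hn hM, dotProduct_smul, topVec_dotProduct_self hn hM, smul_eq_mul, mul_one]

theorem topVec_dotProduct_mulVec_le (hn : 0 < n) {M' : Matrix (Fin n) (Fin n) ℝ}
    (hM : M.IsHermitian) (hM' : M'.IsHermitian) :
    topVec M ⬝ᵥ M' *ᵥ topVec M ≤ largestEigenvalue M' := by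
  simpa [topVec_dotProduct_self hn hM] using
    dotProduct_mulVec_le_largestEigenvalue hn hM' (topVec M)

end LargestEigenvalue

section Edges

open Matrix

variable {V : Type*}

/-- The symmetric `0`-`1` matrix whose entry at `(i, j)` is the bit `x s(i, j)`. -/
def adjMat (x : Sym2 V → Bool) : Matrix V V ℝ := Matrix.of fun i j => if x s(i, j) then 1 else 0

/-- The matrix `adjMat x` minus the mean `q` of its entries. -/
noncomputable def centeredMat (q : unitInterval) (x : Sym2 V → Bool) : Matrix V V ℝ :=
  Matrix.of fun i j => centeredBit q (x s(i, j))

theorem isHermitian_adjMat (x : Sym2 V → Bool) : (adjMat x).IsHermitian := by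
  ext i j
  simp [adjMat, Sym2.eq_swap]

theorem isHermitian_centeredMat (q : unitInterval) (x : Sym2 V → Bool) :
    (centeredMat q x).IsHermitian := by
  ext i j
  simp [centeredMat, Sym2.eq_swap]

theorem adjMat_eq_const_add_centeredMat (q : unitInterval) (x : Sym2 V → Bool) :
    adjMat x = (Matrix.of fun _ _ => (q : ℝ)) + centeredMat q x := by
  ext i j
  simp [adjMat, centeredMat, centeredBit]

variable [Fintype V]

theorem dotProduct_adjMat_mulVec (q : unitInterval) (x : Sym2 V → Bool) (u : V → ℝ) :
    u ⬝ᵥ adjMat x *ᵥ u = q * (∑ i, u i) ^ 2 + u ⬝ᵥ centeredMat q x *ᵥ u := by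
  rw [adjMat_eq_const_add_centeredMat q, add_mulVec, dotProduct_add, dotProduct_const_mulVec]

theorem integral_dotProduct_centeredMat_mulVec (q : unitInterval) (u : V → ℝ) :
    ∫ x, u ⬝ᵥ centeredMat q x *ᵥ u ∂cubeMeasure (Sym2 V) q = 0 := by
  have hentry (i j : V) : ∫ x, centeredMat q x i j ∂cubeMeasure (Sym2 V) q = 0 :=
    integral_centeredBit_eval q s(i, j)
  simp_rw [dotProduct_mulVec_eq_sum]
  rw [integral_finsetSum _ fun _ _ => .of_finite]
  refine Finset.sum_eq_zero fun i _ => ?_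
  rw [integral_finsetSum _ fun _ _ => .of_finite]
  exact Finset.sum_eq_zero fun j _ => by rw [integral_mul_const, hentry, zero_mul]

variable [DecidableEq V]

/-- The number of positions `(i, j)` of a symmetric matrix that share the entry indexed by `e`. -/
noncomputable def edgeMult (e : Sym2 V) : ℝ :=
  (Finset.univ.filter fun p : V × V => s(p.1, p.2) = e).card

theorem sum_sum_sym2 (F : Sym2 V → ℝ) : ∑ i, ∑ j, F s(i, j) = ∑ e, edgeMult e * F e := by
  rw [← Fintype.sum_prod_type' fun i j => F s(i, j),
    ← Finset.sum_fiberwise Finset.univ fun p : V × V => s(p.1, p.2)]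
  refine Finset.sum_congr rfl fun e _ => ?_
  rw [edgeMult, ← nsmul_eq_mul, ← Finset.sum_const]
  exact Finset.sum_congr rfl fun p hp => by rw [(Finset.mem_filter.1 hp).2]

theorem edgeMult_mk (i j : V) : edgeMult s(i, j) = if i = j then 1 else 2 := by
  have hfiber : (Finset.univ.filter fun p : V × V => s(p.1, p.2) = s(i, j)) = {(i, j), (j, i)} := by
    ext p
    simp [Prod.ext_iff]
  rw [edgeMult, hfiber]
  split_ifs with hij
  · simp [hij]
  · rw [Finset.card_pair (by simp [hij])]
    norm_num

theorem edgeMult_nonneg (e : Sym2 V) : 0 ≤ edgeMult e := Nat.cast_nonneg _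

theorem edgeMult_le_two (e : Sym2 V) : edgeMult e ≤ 2 := by
  induction e with
  | _ i j =>
    rw [edgeMult_mk]
    split_ifs <;> norm_num

theorem sum_edgeMult_sq :
    ∑ e : Sym2 V, edgeMult e ^ 2 = 2 * (Fintype.card V : ℝ) ^ 2 - Fintype.card V := by
  have hmult (i j : V) : edgeMult s(i, j) = 2 - if i = j then 1 else 0 := by
    rw [edgeMult_mk]
    split_ifs <;> norm_num
  simp only [sq, ← sum_sum_sym2, hmult, Finset.sum_sub_distrib, Finset.sum_const,
    Finset.sum_ite_eq, Finset.mem_univ, if_true, Finset.card_univ, nsmul_eq_mul, mul_one]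
  ring

theorem dotProduct_adjMat_mulVec_eq_sum (x : Sym2 V → Bool) (u : V → ℝ) :
    u ⬝ᵥ adjMat x *ᵥ u = ∑ e, edgeMult e * ((if x e then 1 else 0) * (e.map u).mul) := by
  rw [dotProduct_mulVec_eq_sum, ← sum_sum_sym2 fun e => (if x e then 1 else 0) * (e.map u).mul]
  simp [adjMat]

theorem dotProduct_adjMat_update_sub (x : Sym2 V → Bool) (e : Sym2 V) (u : V → ℝ) :
    u ⬝ᵥ adjMat (Function.update x e true) *ᵥ u - u ⬝ᵥ adjMat (Function.update x e false) *ᵥ u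
      = edgeMult e * (e.map u).mul := by
  rw [dotProduct_adjMat_mulVec_eq_sum, dotProduct_adjMat_mulVec_eq_sum, ← Finset.sum_sub_distrib,
    Finset.sum_eq_single_of_mem e (Finset.mem_univ e)]
  · simp
  · intro b _ hb
    simp [Function.update_of_ne hb]

end Edges

section EigenvalueDeviation

open Matrix

variable {n : ℕ}

/-- The mean of the row sums of `adjMat x`, which is its Rayleigh quotient at the vector `1`. -/
noncomputable def meanDegree (x : Sym2 (Fin n) → Bool) : ℝ := 1 ⬝ᵥ adjMat x *ᵥ 1 / n

theorem meanDegree_eq (hn : 0 < n) (q : unitInterval) (x : Sym2 (Fin n) → Bool) :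
    meanDegree x = n * q + 1 ⬝ᵥ centeredMat q x *ᵥ 1 / n := by
  rw [meanDegree, dotProduct_adjMat_mulVec q]
  simp
  field_simp

theorem meanDegree_le_largestEigenvalue (hn : 0 < n) (x : Sym2 (Fin n) → Bool) :
    meanDegree x ≤ largestEigenvalue (adjMat x) := by
  have h := dotProduct_mulVec_le_largestEigenvalue hn (isHermitian_adjMat x) 1
  rw [one_dotProduct_one, Fintype.card_fin] at h
  exact (div_le_iff₀ (by positivity)).2 h

theorem meanDegree_update_sub (x : Sym2 (Fin n) → Bool) (e : Sym2 (Fin n)) :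
    meanDegree (Function.update x e true) - meanDegree (Function.update x e false)
      = edgeMult e * (1 / n) := by
  have hone : (e.map (1 : Fin n → ℝ)).mul = 1 := by induction e with | _ i j => simp
  rw [meanDegree, meanDegree, ← sub_div, dotProduct_adjMat_update_sub, hone]
  ring

/-- The deviation of the largest eigenvalue from the mean degree. -/
noncomputable def eigDev (x : Sym2 (Fin n) → Bool) : ℝ :=
  largestEigenvalue (adjMat x) - meanDegree x

/-- By the Rayleigh principle, flipping the bit `e` changes the largest eigenvalue by at least
`edgeMult e * v i * v j` for the old top eigenvector `v`, and by at most the same expression for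
the new one. -/
theorem sq_eigDev_update_sub_le (hn : 0 < n) (x : Sym2 (Fin n) → Bool) (e : Sym2 (Fin n)) :
    (eigDev (Function.update x e true) - eigDev (Function.update x e false)) ^ 2 ≤
      (edgeMult e * ((e.map (topVec (adjMat (Function.update x e true)))).mul - 1 / n)) ^ 2
      + (edgeMult e * ((e.map (topVec (adjMat (Function.update x e false)))).mul - 1 / n)) ^ 2 := by
  set x₁ := Function.update x e true
  set x₀ := Function.update x e false
  have hmean : meanDegree x₁ - meanDegree x₀ = edgeMult e * (1 / n) := meanDegree_update_sub x e
  have hupper : largestEigenvalue (adjMat x₁) - largestEigenvalue (adjMat x₀)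
      ≤ edgeMult e * (e.map (topVec (adjMat x₁))).mul := by
    rw [← dotProduct_adjMat_update_sub x,
      ← topVec_dotProduct_mulVec_topVec hn (isHermitian_adjMat x₁)]
    gcongr
    exact topVec_dotProduct_mulVec_le hn (isHermitian_adjMat x₁) (isHermitian_adjMat x₀)
  have hlower : edgeMult e * (e.map (topVec (adjMat x₀))).mul
      ≤ largestEigenvalue (adjMat x₁) - largestEigenvalue (adjMat x₀) := by
    rw [← dotProduct_adjMat_update_sub x,
      ← topVec_dotProduct_mulVec_topVec hn (isHermitian_adjMat x₀)]
    gcongr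
    exact topVec_dotProduct_mulVec_le hn (isHermitian_adjMat x₀) (isHermitian_adjMat x₁)
  simp only [eigDev, mul_sub]
  rcases le_total 0 (largestEigenvalue (adjMat x₁) - meanDegree x₁
    - (largestEigenvalue (adjMat x₀) - meanDegree x₀)) with h | h
  · exact le_add_of_le_of_nonneg (pow_le_pow_left₀ h (by linarith) 2) (sq_nonneg _)
  · exact le_add_of_nonneg_of_le (sq_nonneg _) (sq_le_sq.2 (abs_le_abs_of_nonpos h (by linarith)))

/-- The symmetric matrix whose entry is `1 - q` where `adjMat x` has a one and `q` where it has a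
zero: these are the Efron–Stein weights of the possible flips. -/
noncomputable def flipWeight (q : unitInterval) (x : Sym2 (Fin n) → Bool) :
    Matrix (Fin n) (Fin n) ℝ :=
  Matrix.of fun i j => (if x s(i, j) then 1 - q else q : ℝ)

theorem dotProduct_flipWeight_mulVec (q : unitInterval) (x : Sym2 (Fin n) → Bool) (u : Fin n → ℝ) :
    u ⬝ᵥ flipWeight q x *ᵥ u
      = 2 * q * (1 - q) * (∑ i, u i) ^ 2 + (1 - 2 * q) * (u ⬝ᵥ centeredMat q x *ᵥ u) := by
  have hsplit : flipWeight q x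
      = (Matrix.of fun _ _ => (2 * q * (1 - q) : ℝ)) + (1 - 2 * q : ℝ) • centeredMat q x := by
    ext i j
    simp only [flipWeight, centeredMat, centeredBit, Matrix.of_apply, Matrix.add_apply,
      Matrix.smul_apply, smul_eq_mul]
    split_ifs <;> ring
  rw [hsplit, add_mulVec, dotProduct_add, dotProduct_const_mulVec, smul_mulVec, dotProduct_smul,
    smul_eq_mul]

theorem variance_eigDev_le_integral_flipWeight (hn : 0 < n) (q : unitInterval) :
    Var[eigDev (n := n); cubeMeasure (Sym2 (Fin n)) q] ≤
      2 * ∫ x, ∑ i, ∑ j, flipWeight q x i j *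
        (topVec (adjMat x) i * topVec (adjMat x) j - 1 / n) ^ 2 ∂cubeMeasure (Sym2 (Fin n)) q := by
  refine (variance_cubeMeasure_le_sum q _ (fun e x =>
    (edgeMult e * ((e.map (topVec (adjMat x))).mul - 1 / n)) ^ 2)
    fun e x => sq_eigDev_update_sub_le hn x e).trans ?_
  rw [← integral_finsetSum _ fun _ _ => .of_finite, ← integral_const_mul]
  refine integral_mono .of_finite .of_finite fun x => ?_
  have hedges := sum_sum_sym2 fun e : Sym2 (Fin n) =>
    (if x e then 1 - q else q : ℝ) * ((e.map (topVec (adjMat x))).mul - 1 / n) ^ 2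
  simp only [Sym2.map_mk, Sym2.mul_mk] at hedges
  simp only [flipWeight, Matrix.of_apply, hedges, Finset.mul_sum]
  refine Finset.sum_le_sum fun e _ => ?_
  have hweight : 0 ≤ (if x e then 1 - q else q : ℝ) := by
    have := q.2.1
    have := q.2.2
    split_ifs <;> linarith
  calc (if x e then 1 - q else q : ℝ) * (edgeMult e * ((e.map (topVec (adjMat x))).mul - 1 / n)) ^ 2
      = edgeMult e * (edgeMult e *
          ((if x e then 1 - q else q : ℝ) * ((e.map (topVec (adjMat x))).mul - 1 / n) ^ 2)) := by
        ring
    _ ≤ 2 * (edgeMult e *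
          ((if x e then 1 - q else q : ℝ) * ((e.map (topVec (adjMat x))).mul - 1 / n) ^ 2)) := by
        have := edgeMult_nonneg e
        gcongr
        exact edgeMult_le_two e

theorem sum_flipWeight_mul_le (hn : 0 < n) (q : unitInterval) (x : Sym2 (Fin n) → Bool) :
    ∑ i, ∑ j, flipWeight q x i j * (topVec (adjMat x) i * topVec (adjMat x) j - 1 / n) ^ 2 ≤
      (1 - 2 * q) * (topVec (adjMat x) ^ 2 ⬝ᵥ centeredMat q x *ᵥ topVec (adjMat x) ^ 2)
      + 2 / n * (topVec (adjMat x) ⬝ᵥ centeredMat q x *ᵥ topVec (adjMat x))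
      - (3 - 2 * q) / n ^ 2 * (1 ⬝ᵥ centeredMat q x *ᵥ 1) := by
  have : (0 : ℝ) < n := by positivity
  have hq : (0 : ℝ) ≤ 1 - q := sub_nonneg.2 q.2.2
  have hsum : ∑ i, (topVec (adjMat x) ^ 2) i = 1 := by
    simpa [dotProduct, sq] using topVec_dotProduct_self hn (isHermitian_adjMat x)
  have htop := meanDegree_le_largestEigenvalue hn x
  rw [meanDegree_eq hn q, ← topVec_dotProduct_mulVec_topVec hn (isHermitian_adjMat x),
    dotProduct_adjMat_mulVec q] at htop
  rw [sum_mul_mul_sub_sq, dotProduct_flipWeight_mulVec, dotProduct_flipWeight_mulVec,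
    dotProduct_flipWeight_mulVec, hsum]
  simp only [Pi.one_apply, Finset.sum_const, Finset.card_univ, Fintype.card_fin, nsmul_eq_mul,
    mul_one, one_pow]
  set s := ∑ i, topVec (adjMat x) i
  set b := topVec (adjMat x) ⬝ᵥ centeredMat q x *ᵥ topVec (adjMat x)
  set c := 1 ⬝ᵥ centeredMat q x *ᵥ 1
  have hscaled := mul_le_mul_of_nonneg_left htop (show 0 ≤ 4 * (1 - q) / (n : ℝ) by positivity)
  have h₁ : 4 * (1 - q) / (n : ℝ) * (n * q + c / n)
      = 4 * q * (1 - q) + 4 * (1 - q) / n ^ 2 * c := by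
    field_simp
  have h₂ : (1 / (n : ℝ)) ^ 2 * (2 * q * (1 - q) * n ^ 2 + (1 - 2 * q) * c)
      = 2 * q * (1 - q) + (1 - 2 * q) / n ^ 2 * c := by
    field_simp
  rw [h₁] at hscaled
  rw [h₂]
  linear_combination hscaled

theorem variance_eigDev_le_integral (hn : 0 < n) (q : unitInterval) :
    Var[eigDev (n := n); cubeMeasure (Sym2 (Fin n)) q] ≤
      2 * ∫ x, ((1 - 2 * q) * (topVec (adjMat x) ^ 2 ⬝ᵥ centeredMat q x *ᵥ topVec (adjMat x) ^ 2)
        + 2 / n * (topVec (adjMat x) ⬝ᵥ centeredMat q x *ᵥ topVec (adjMat x)))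
        ∂cubeMeasure (Sym2 (Fin n)) q := by
  refine (variance_eigDev_le_integral_flipWeight hn q).trans ?_
  refine mul_le_mul_of_nonneg_left ?_ zero_le_two
  refine (integral_mono .of_finite .of_finite (sum_flipWeight_mul_le hn q)).trans_eq ?_
  rw [integral_sub .of_finite .of_finite, integral_const_mul (_ / _),
    integral_dotProduct_centeredMat_mulVec, mul_zero, sub_zero]

end EigenvalueDeviation

section Moments

open Matrix

section ImageCount

variable {V : Type*} [DecidableEq V]

theorem image_cons_sdiff {m : ℕ} (z : V) (Z : Fin m → V) (S : Finset V) :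
    Finset.univ.image (Fin.cons z Z : Fin (m + 1) → V) \ S =
      if z ∈ S then Finset.univ.image Z \ insert z S
      else insert z (Finset.univ.image Z \ insert z S) := by
  ext w
  by_cases hw : w = z <;> by_cases hz : z ∈ S <;> simp [Fin.exists_fin_succ, hz, hw, eq_comm]

variable [Fintype V]

theorem sum_ite_mem_one_inv_card_le (S : Finset V) :
    ∑ z, (if z ∈ S then (1 : ℝ) else (Fintype.card V : ℝ)⁻¹) ≤ S.card + 1 := by
  calc ∑ z, (if z ∈ S then (1 : ℝ) else (Fintype.card V : ℝ)⁻¹)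
      ≤ ∑ z, ((if z ∈ S then (1 : ℝ) else 0) + (Fintype.card V : ℝ)⁻¹) := by
        refine Finset.sum_le_sum fun z _ => ?_
        split_ifs <;> simp
    _ ≤ S.card + 1 := by
        rw [Finset.sum_add_distrib]
        gcongr
        · simp
        · simpa using mul_inv_le_one

/-- A new value outside `S` is weighted by the inverse of the number of ways to choose it, and a
repeated one can be chosen in at most `S.card + m` ways. -/
theorem sum_inv_card_pow_card_image_sdiff_le_fin (m : ℕ) (S : Finset V) :
    ∑ Z : Fin m → V, (Fintype.card V : ℝ)⁻¹ ^ (Finset.univ.image Z \ S).card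
      ≤ ((S.card : ℝ) + m) ^ m := by
  induction m generalizing S with
  | zero => simp
  | succ m ih =>
    set a : ℝ := (Fintype.card V : ℝ)⁻¹
    have ha : 0 ≤ a := by positivity
    calc ∑ Z : Fin (m + 1) → V, a ^ (Finset.univ.image Z \ S).card
        = ∑ z, (if z ∈ S then 1 else a) *
            ∑ Z : Fin m → V, a ^ (Finset.univ.image Z \ insert z S).card := by
          rw [← (Fin.consEquiv fun _ => V).sum_comp, Fintype.sum_prod_type]
          refine Fintype.sum_congr _ _ fun z => ?_
          rw [Finset.mul_sum]
          refine Fintype.sum_congr _ _ fun Z => ?_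
          change a ^ (Finset.univ.image (Fin.cons z Z : Fin (m + 1) → V) \ S).card = _
          rw [image_cons_sdiff]
          split_ifs
          · rw [one_mul]
          · rw [Finset.card_insert_of_notMem (by simp), pow_succ']
      _ ≤ ∑ z, (if z ∈ S then 1 else a) * ((S.card : ℝ) + (m + 1 : ℕ)) ^ m := by
          refine Finset.sum_le_sum fun z _ => ?_
          gcongr
          refine (ih (insert z S)).trans (pow_le_pow_left₀ (by positivity) ?_ m)
          have : ((insert z S).card : ℝ) ≤ S.card + 1 := by
            exact_mod_cast Finset.card_insert_le z S
          push_cast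
          linarith
      _ ≤ ((S.card : ℝ) + (m + 1 : ℕ)) ^ (m + 1) := by
          rw [← Finset.sum_mul, pow_succ']
          gcongr
          refine (sum_ite_mem_one_inv_card_le S).trans ?_
          push_cast
          linarith [m.cast_nonneg (α := ℝ)]

theorem sum_inv_card_pow_card_image_sdiff_le {τ : Type*} [Fintype τ] [DecidableEq τ]
    (S : Finset V) :
    ∑ Z : τ → V, (Fintype.card V : ℝ)⁻¹ ^ (Finset.univ.image Z \ S).card
      ≤ ((S.card : ℝ) + Fintype.card τ) ^ Fintype.card τ := by
  refine le_of_eq_of_le ?_ (sum_inv_card_pow_card_image_sdiff_le_fin (Fintype.card τ) S)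
  rw [← (Equiv.arrowCongr (Fintype.equivFin τ) (Equiv.refl V)).sum_comp]
  refine Fintype.sum_congr _ _ fun Z => ?_
  congr 3
  ext w
  simp [(Fintype.equivFin τ).symm.surjective.exists]

end ImageCount

section Walks

variable {V : Type*} {k : ℕ}

/-- The vertices of the walk that starts in `i` and then visits `y 0`, `y 1`, … -/
def walkVertex (i : V) (y : Fin k → V) : Fin (k + 1) → V := Fin.cons i y

/-- The edge used in step `t` of the walk that starts in `i` and then visits `y 0`, `y 1`, … -/
def walkEdge (i : V) (y : Fin k → V) (t : Fin k) : Sym2 V := s(walkVertex i y t.castSucc, y t)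

theorem exists_lt_of_walkVertex_castSucc_eq {i w : V} {y : Fin k → V} {t : Fin k}
    (h : walkVertex i y t.castSucc = w) (hw : w ≠ i) : ∃ t' < t, y t' = w := by
  obtain ⟨t, ht⟩ := t
  cases t with
  | zero => exact absurd h.symm hw
  | succ t => exact ⟨⟨t, by omega⟩, by simp [Fin.lt_def], h⟩

theorem exists_first_visit {ρ : Type*} {Y : ρ → Fin k → V} {w : V} (hw : ∃ s t, Y s t = w) :
    ∃ s t, Y s t = w ∧ ∀ s' t', Y s' t' = w → t ≤ t' := by
  classical
  have hex : ∃ m, ∃ s t, Y s t = w ∧ (t : ℕ) = m := by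
    obtain ⟨s, t, h⟩ := hw
    exact ⟨t, s, t, h, rfl⟩
  obtain ⟨s, t, h, ht⟩ := Nat.find_spec hex
  exact ⟨s, t, h, fun s' t' h' => ht.trans_le (Nat.find_min' hex ⟨s', t', h', rfl⟩)⟩

/-- Charge every visited vertex other than `i` to the edge through which some walk first reaches
it; if two vertices shared that edge, each would have been visited before the other. -/
theorem card_image_sdiff_le_card_walkEdge [DecidableEq V] {ρ : Type*} [Fintype ρ] (i : V)
    (Y : ρ → Fin k → V) :
    (Finset.univ.image (fun p : ρ × Fin k => Y p.1 p.2) \ {i}).card ≤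
      (Finset.univ.image (fun p : ρ × Fin k => walkEdge i (Y p.1) p.2)).card := by
  have hfirst (w : V) (hw : w ∈ Finset.univ.image (fun p : ρ × Fin k => Y p.1 p.2) \ {i}) :
      ∃ p : ρ × Fin k, w ≠ i ∧ Y p.1 p.2 = w ∧ ∀ s' t', Y s' t' = w → p.2 ≤ t' := by
    simp only [Finset.mem_sdiff, Finset.mem_image, Finset.mem_univ, true_and, Prod.exists,
      Finset.mem_singleton] at hw
    obtain ⟨s, t, h⟩ := exists_first_visit hw.1
    exact ⟨(s, t), hw.2, h⟩
  choose p hne hp hmin using hfirst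
  have hearlier {w w'} (hw) (hw') (h : walkVertex i (Y (p w hw).1) (p w hw).2.castSucc = w') :
      (p w' hw').2 < (p w hw).2 := by
    obtain ⟨t, ht, hYt⟩ := exists_lt_of_walkVertex_castSucc_eq h (hne w' hw')
    exact (hmin w' hw' _ t hYt).trans_lt ht
  refine Finset.card_le_card_of_forall_subsingleton
    (fun w e => ∃ hw, walkEdge i (Y (p w hw).1) (p w hw).2 = e)
    (fun w hw => ⟨_, Finset.mem_image_of_mem _ (Finset.mem_univ (p w hw)), hw, rfl⟩) ?_
  rintro - - w ⟨-, hw, rfl⟩ w' ⟨-, hw', h⟩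
  rw [walkEdge, walkEdge, hp, hp, Sym2.eq_iff] at h
  rcases h with ⟨-, h⟩ | ⟨h, h'⟩
  · exact h.symm
  · exact absurd (hearlier hw' hw h) (hearlier hw hw' h'.symm).le.not_gt

theorem centeredMat_pow_mulVec [Fintype V] [DecidableEq V] (q : unitInterval) (x : Sym2 V → Bool)
    (u : V → ℝ) (k : ℕ) (i : V) :
    (centeredMat q x ^ k *ᵥ u) i = ∑ y : Fin k → V,
      (∏ t, centeredBit q (x (walkEdge i y t))) * u (walkVertex i y (Fin.last k)) := by
  induction k generalizing i with
  | zero => simp [walkVertex]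
  | succ k ih =>
    rw [pow_succ', ← mulVec_mulVec, mulVec, dotProduct,
      ← (Fin.consEquiv fun _ => V).sum_comp, Fintype.sum_prod_type]
    refine Fintype.sum_congr _ _ fun j => ?_
    rw [ih, Finset.mul_sum]
    refine Fintype.sum_congr _ _ fun y => ?_
    change _ = (∏ t, centeredBit q (x (walkEdge i (Fin.cons j y : Fin (k + 1) → V) t))) * _
    rw [Fin.prod_univ_succ, mul_assoc]
    rfl

end Walks

variable {V : Type*} [Fintype V] [DecidableEq V]

theorem centeredMat_pow_mulVec_pow (q : unitInterval) (x : Sym2 V → Bool) (u : V → ℝ) (k m : ℕ)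
    (i : V) :
    (centeredMat q x ^ k *ᵥ u) i ^ m = ∑ Y : Fin m → Fin k → V,
      (∏ s, u (walkVertex i (Y s) (Fin.last k))) *
        ∏ p : Fin m × Fin k, centeredBit q (x (walkEdge i (Y p.1) p.2)) := by
  rw [centeredMat_pow_mulVec, Fintype.sum_pow]
  refine Fintype.sum_congr _ _ fun Y => ?_
  rw [Finset.prod_mul_distrib, mul_comm, Fintype.prod_prod_type]

theorem abs_integral_prod_walkEdge_le {ρ : Type*} [Fintype ρ] (q : unitInterval)
    (hd : 1 ≤ Fintype.card V * (q * (1 - q) : ℝ)) {k : ℕ} (i : V) (Y : ρ → Fin k → V) :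
    |∫ x, ∏ p : ρ × Fin k, centeredBit q (x (walkEdge i (Y p.1) p.2)) ∂cubeMeasure (Sym2 V) q| ≤
      (Fintype.card V * (q * (1 - q) : ℝ)) ^ (Fintype.card ρ * k / 2) * (Fintype.card V : ℝ)⁻¹ ^
        (Finset.univ.image (fun p : ρ × Fin k => Y p.1 p.2) \ {i}).card := by
  refine (abs_integral_prod_centeredBit_le q _).trans ?_
  have hq : 0 ≤ (q * (1 - q) : ℝ) := mul_one_sub_nonneg q
  have hq1 : (q * (1 - q) : ℝ) ≤ 1 := mul_le_one₀ q.2.2 (sub_nonneg.2 q.2.2) (by linarith [q.2.1])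
  have : Nonempty V := ⟨i⟩
  have hcard := card_image_sdiff_le_card_walkEdge i Y
  set D := (Finset.univ.image fun p : ρ × Fin k => walkEdge i (Y p.1) p.2).card
  set r := (Finset.univ.image (fun p : ρ × Fin k => Y p.1 p.2) \ {i}).card
  split_ifs with hD
  · rw [Fintype.card_prod, Fintype.card_fin] at hD
    calc (q * (1 - q) : ℝ) ^ D ≤ (q * (1 - q)) ^ r := pow_le_pow_of_le_one hq hq1 hcard
      _ = (Fintype.card V * (q * (1 - q) : ℝ)) ^ r * (Fintype.card V : ℝ)⁻¹ ^ r := by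
          rw [← mul_pow]
          field_simp
      _ ≤ (Fintype.card V * (q * (1 - q) : ℝ)) ^ (Fintype.card ρ * k / 2)
          * (Fintype.card V : ℝ)⁻¹ ^ r := by
          gcongr
          omega
  · positivity

theorem abs_integral_centeredMat_pow_mulVec_pow_le (q : unitInterval)
    (hd : 1 ≤ Fintype.card V * (q * (1 - q) : ℝ)) {u : V → ℝ} (hu : ∀ j, |u j| ≤ 1) (k m : ℕ)
    (i : V) :
    |∫ x, (centeredMat q x ^ k *ᵥ u) i ^ m ∂cubeMeasure (Sym2 V) q| ≤
      (1 + m * k : ℝ) ^ (m * k) * (Fintype.card V * (q * (1 - q) : ℝ)) ^ (m * k / 2) := by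
  simp_rw [centeredMat_pow_mulVec_pow]
  rw [integral_finsetSum _ fun _ _ => .of_finite]
  simp_rw [integral_const_mul]
  have hterm (Y : Fin m → Fin k → V) := abs_integral_prod_walkEdge_le q hd i Y
  have hunit (Y : Fin m → Fin k → V) : |∏ s, u (walkVertex i (Y s) (Fin.last k))| ≤ 1 := by
    rw [Finset.abs_prod]
    exact Finset.prod_le_one (fun _ _ => abs_nonneg _) fun _ _ => hu _
  calc |∑ Y : Fin m → Fin k → V, (∏ s, u (walkVertex i (Y s) (Fin.last k))) *
        ∫ x, ∏ p : Fin m × Fin k, centeredBit q (x (walkEdge i (Y p.1) p.2))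
          ∂cubeMeasure (Sym2 V) q|
      ≤ ∑ Y : Fin m → Fin k → V, (Fintype.card V * (q * (1 - q) : ℝ)) ^ (m * k / 2) *
          (Fintype.card V : ℝ)⁻¹ ^
            (Finset.univ.image (fun p : Fin m × Fin k => Y p.1 p.2) \ {i}).card := by
        refine (Finset.abs_sum_le_sum_abs _ _).trans (Finset.sum_le_sum fun Y _ => ?_)
        rw [abs_mul]
        refine (mul_le_of_le_one_left (abs_nonneg _) (hunit Y)).trans ?_
        simpa using hterm Y
    _ ≤ (1 + m * k : ℝ) ^ (m * k) * (Fintype.card V * (q * (1 - q) : ℝ)) ^ (m * k / 2) := by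
        rw [← Finset.mul_sum, mul_comm]
        gcongr
        have h := sum_inv_card_pow_card_image_sdiff_le (τ := Fin m × Fin k) ({i} : Finset V)
        rw [← (Equiv.curry (Fin m) (Fin k) V).symm.sum_comp] at h
        refine le_of_eq_of_le ?_ (h.trans_eq ?_)
        · rfl
        · simp

end Moments

section Delocalization

open Matrix
open scoped Matrix.Norms.L2Operator

variable {n : ℕ}

theorem largestEigenvalue_smul_topVec (hn : 0 < n) (q : unitInterval)
    (x : Sym2 (Fin n) → Bool) :
    largestEigenvalue (adjMat x) • topVec (adjMat x)
      = (q * ∑ i, topVec (adjMat x) i) • (1 : Fin n → ℝ)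
        + centeredMat q x *ᵥ topVec (adjMat x) := by
  have hconst (u : Fin n → ℝ) : (Matrix.of fun _ _ => (q : ℝ)) *ᵥ u
      = (q * ∑ i, u i) • (1 : Fin n → ℝ) := by
    ext i
    simp [mulVec, dotProduct, Finset.mul_sum]
  conv_lhs => rw [← mulVec_topVec hn (isHermitian_adjMat x), adjMat_eq_const_add_centeredMat q]
  rw [add_mulVec, ← adjMat_eq_const_add_centeredMat, hconst]

theorem sub_norm_centeredMat_le_largestEigenvalue (hn : 0 < n) (q : unitInterval)
    (x : Sym2 (Fin n) → Bool) : (n * q : ℝ) - ‖centeredMat q x‖ ≤ largestEigenvalue (adjMat x) := by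
  have hone := neg_le_of_abs_le (abs_dotProduct_mulVec_le (centeredMat q x) 1)
  rw [one_dotProduct_one, Fintype.card_fin, ← neg_mul, ← le_div_iff₀ (by positivity)] at hone
  have hmean := meanDegree_le_largestEigenvalue hn x
  rw [meanDegree_eq hn q] at hmean
  linarith

theorem sum_abs_topVec_sq_le (hn : 0 < n) (x : Sym2 (Fin n) → Bool) :
    (∑ i, |topVec (adjMat x) i|) ^ 2 ≤ n := by
  have h := sq_sum_le_card_mul_dotProduct_self fun i => |topVec (adjMat x) i|
  have hunit := topVec_dotProduct_self hn (isHermitian_adjMat x)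
  simp only [dotProduct, abs_mul_abs_self] at h hunit
  simpa [hunit] using h

theorem mul_div_pow_succ_pow_four_le {ν r q s l : ℝ} (hν : 0 < ν) (hr : 0 < r) (hrq : r ≤ ν * q)
    (hl : ν * q / 2 ≤ l) (hs : s ^ 2 ≤ ν) (k : ℕ) :
    (q * s / l ^ (k + 1)) ^ 4 ≤ 16 ^ (k + 1) / (ν ^ 2 * r ^ (4 * k)) := by
  have hl0 : 0 < l := by linarith
  have hrl : r / l ≤ 2 := by
    rw [div_le_iff₀ hl0]
    linarith
  have hqs : (q * s / l) ^ 4 ≤ 16 / ν ^ 2 := by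
    have hql : (ν * q / l) ≤ 2 := by
      rw [div_le_iff₀ hl0]
      linarith
    calc (q * s / l) ^ 4 = (ν * q / l) ^ 4 * (s ^ 2) ^ 2 / ν ^ 4 := by field_simp
      _ ≤ 2 ^ 4 * ν ^ 2 / ν ^ 4 := by
        have : 0 ≤ ν * q / l := div_nonneg (hr.le.trans hrq) hl0.le
        gcongr
      _ = 16 / ν ^ 2 := by
        field_simp
        norm_num
  calc (q * s / l ^ (k + 1)) ^ 4 = (q * s / l) ^ 4 * ((r / l) ^ 4) ^ k / r ^ (4 * k) := by
        rw [← pow_mul, div_pow r, div_pow, div_pow, ← pow_mul, add_mul, pow_add, mul_comm k]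
        field_simp
    _ ≤ 16 / ν ^ 2 * (2 ^ 4) ^ k / r ^ (4 * k) := by gcongr
    _ = 16 ^ (k + 1) / (ν ^ 2 * r ^ (4 * k)) := by
        norm_num
        field_simp
        ring

/-- A bound for the sum of the fourth powers of the entries of the top eigenvector, read off its
expansion in the iterates `H ^ k *ᵥ 1` of the centered matrix `H`, truncated at `k = N`. The
parameter `δ` is the fourth root of the variance `n * q * (1 - q)` of a row sum. -/
noncomputable def iterateBound (N : ℕ) (δ : ℝ) (q : unitInterval) (x : Sym2 (Fin n) → Bool) : ℝ :=
  8 * (N ^ 3 * ∑ k ∈ Finset.range N, 16 ^ (k + 1) / ((n : ℝ) ^ 2 * (δ ^ 4) ^ (4 * k)) *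
    ∑ i, (centeredMat q x ^ k *ᵥ 1) i ^ 4 + 16 ^ N / δ ^ (4 * N))

variable {q : unitInterval} {δ : ℝ}

theorem half_le_largestEigenvalue (hn : 0 < n) (hδ : 2 ≤ δ) (hd : δ ^ 4 ≤ n * q)
    {x : Sym2 (Fin n) → Bool} (hH : ‖centeredMat q x‖ ≤ δ ^ 3) :
    (n * q / 2 : ℝ) ≤ largestEigenvalue (adjMat x) := by
  have hhalf : δ ^ 3 ≤ δ ^ 4 / 2 := by
    have : 0 < δ ^ 3 := by positivity
    nlinarith
  have := sub_norm_centeredMat_le_largestEigenvalue hn q x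
  linarith

theorem sum_topVec_pow_four_le_iterateBound (hn : 0 < n) (hδ : 2 ≤ δ) (hd : δ ^ 4 ≤ n * q)
    {x : Sym2 (Fin n) → Bool} (hH : ‖centeredMat q x‖ ≤ δ ^ 3) (N : ℕ) :
    ∑ i, topVec (adjMat x) i ^ 4 ≤ iterateBound N δ q x := by
  have hn0 : (0 : ℝ) < n := by positivity
  have hδ0 : 0 < δ := by linarith
  have hl := half_le_largestEigenvalue hn hδ hd hH
  have hδl : δ ^ 4 / 2 ≤ largestEigenvalue (adjMat x) := by linarith
  have hl0 : 0 < largestEigenvalue (adjMat x) := lt_of_lt_of_le (by positivity) hδl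
  have hsum : (∑ i, topVec (adjMat x) i) ^ 2 ≤ n :=
    (sq_le_sq.2 ((Finset.abs_sum_le_sum_abs _ _).trans (le_abs_self _))).trans
      (sum_abs_topVec_sq_le hn x)
  have hratio : ‖centeredMat q x‖ / largestEigenvalue (adjMat x) ≤ 2 / δ := by
    rw [div_le_div_iff₀ hl0 hδ0]
    calc ‖centeredMat q x‖ * δ ≤ δ ^ 3 * δ := by gcongr
      _ ≤ 2 * largestEigenvalue (adjMat x) := by linarith
  refine (sum_pow_four_eigenvector_le hl0.ne' (largestEigenvalue_smul_topVec hn q x)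
    (topVec_dotProduct_self hn (isHermitian_adjMat x)) N).trans ?_
  rw [iterateBound]
  gcongr with k
  · exact mul_div_pow_succ_pow_four_le hn0 (by positivity) hd hl hsum k
  · calc (‖centeredMat q x‖ / largestEigenvalue (adjMat x)) ^ (4 * N) ≤ (2 / δ) ^ (4 * N) := by
          gcongr
      _ = 16 ^ N / δ ^ (4 * N) := by
          rw [div_pow, pow_mul 2]
          norm_num

theorem abs_dotProduct_sq_topVec_add_le_of_norm_le (hn : 0 < n) (hδ : 2 ≤ δ) (hd : δ ^ 4 ≤ n * q)
    {x : Sym2 (Fin n) → Bool} (hH : ‖centeredMat q x‖ ≤ δ ^ 3) (N : ℕ) :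
    |topVec (adjMat x) ^ 2 ⬝ᵥ centeredMat q x *ᵥ topVec (adjMat x) ^ 2|
        + 2 / n * |topVec (adjMat x) ⬝ᵥ centeredMat q x *ᵥ topVec (adjMat x)|
      ≤ δ ^ 3 * (iterateBound N δ q x + 2 / n) := by
  have hquartic : topVec (adjMat x) ^ 2 ⬝ᵥ topVec (adjMat x) ^ 2 ≤ iterateBound N δ q x := by
    refine le_of_eq_of_le ?_ (sum_topVec_pow_four_le_iterateBound hn hδ hd hH N)
    simp only [dotProduct, Pi.pow_apply, ← pow_add, Nat.reduceAdd]
  have hsquare := abs_dotProduct_mulVec_le (centeredMat q x) (topVec (adjMat x))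
  rw [topVec_dotProduct_self hn (isHermitian_adjMat x), mul_one] at hsquare
  calc |topVec (adjMat x) ^ 2 ⬝ᵥ centeredMat q x *ᵥ topVec (adjMat x) ^ 2|
        + 2 / n * |topVec (adjMat x) ⬝ᵥ centeredMat q x *ᵥ topVec (adjMat x)|
      ≤ δ ^ 3 * iterateBound N δ q x + 2 / n * δ ^ 3 := by
        gcongr
        · refine (abs_dotProduct_mulVec_le _ _).trans ?_
          gcongr
          exact dotProduct_self_star_nonneg _
        · exact hsquare.trans hH
    _ = δ ^ 3 * (iterateBound N δ q x + 2 / n) := by ring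

theorem abs_dotProduct_sq_topVec_add_le_three (hn : 0 < n) (q : unitInterval)
    (x : Sym2 (Fin n) → Bool) :
    |topVec (adjMat x) ^ 2 ⬝ᵥ centeredMat q x *ᵥ topVec (adjMat x) ^ 2|
        + 2 / n * |topVec (adjMat x) ⬝ᵥ centeredMat q x *ᵥ topVec (adjMat x)| ≤ 3 := by
  have hentry (i j : Fin n) : |centeredMat q x i j| ≤ 1 := abs_centeredBit_le_one q _
  have hsum : ∑ i, |(topVec (adjMat x) ^ 2) i| = 1 := by
    simpa [dotProduct, sq] using topVec_dotProduct_self hn (isHermitian_adjMat x)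
  calc |topVec (adjMat x) ^ 2 ⬝ᵥ centeredMat q x *ᵥ topVec (adjMat x) ^ 2|
        + 2 / n * |topVec (adjMat x) ⬝ᵥ centeredMat q x *ᵥ topVec (adjMat x)|
      ≤ 1 ^ 2 + 2 / n * n := by
        gcongr
        · rw [← hsum]
          exact abs_dotProduct_mulVec_le_sq_sum_abs hentry _
        · exact (abs_dotProduct_mulVec_le_sq_sum_abs hentry _).trans (sum_abs_topVec_sq_le hn x)
    _ = 3 := by
        field_simp
        norm_num

theorem iterateBound_nonneg (hδ : 0 ≤ δ) (N : ℕ) (x : Sym2 (Fin n) → Bool) :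
    0 ≤ iterateBound N δ q x := by
  unfold iterateBound
  positivity

/-- Where the operator norm of the centered matrix exceeds `δ ^ 3`, the Frobenius norm of its power
`2 ^ m` is so large that the trivial bound suffices. -/
theorem abs_dotProduct_sq_topVec_add_le (hn : 0 < n) (hδ : 2 ≤ δ) (hd : δ ^ 4 ≤ n * q) (N m : ℕ)
    (x : Sym2 (Fin n) → Bool) :
    |topVec (adjMat x) ^ 2 ⬝ᵥ centeredMat q x *ᵥ topVec (adjMat x) ^ 2|
        + 2 / n * |topVec (adjMat x) ⬝ᵥ centeredMat q x *ᵥ topVec (adjMat x)|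
      ≤ δ ^ 3 * (iterateBound N δ q x + 2 / n)
        + 3 / (δ ^ 6) ^ 2 ^ m * ∑ i, ∑ j, (centeredMat q x ^ 2 ^ m) i j ^ 2 := by
  have hδ0 : 0 < δ := by linarith
  rcases le_or_gt ‖centeredMat q x‖ (δ ^ 3) with hH | hH
  · refine (abs_dotProduct_sq_topVec_add_le_of_norm_le hn hδ hd hH N).trans ?_
    exact le_add_of_nonneg_right (by positivity)
  · refine (abs_dotProduct_sq_topVec_add_le_three hn q x).trans ?_
    refine le_add_of_nonneg_of_le ?_ ?_
    · have := iterateBound_nonneg (q := q) hδ0.le N x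
      positivity
    · rw [div_mul_eq_mul_div, le_div_iff₀ (by positivity)]
      gcongr
      calc (δ ^ 6) ^ 2 ^ m = ((δ ^ 3) ^ 2) ^ 2 ^ m := by rw [← pow_mul δ 3]
        _ ≤ (‖centeredMat q x‖ ^ 2) ^ 2 ^ m := by gcongr
        _ ≤ ∑ i, ∑ j, (centeredMat q x ^ 2 ^ m) i j ^ 2 :=
          l2_opNorm_pow_le_sum_sq (isHermitian_centeredMat q x) m

theorem integral_sum_centeredMat_pow_mulVec_pow_four_le (hd : 1 ≤ n * (q * (1 - q) : ℝ)) (k : ℕ) :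
    ∫ x, ∑ i, (centeredMat q x ^ k *ᵥ 1) i ^ 4 ∂cubeMeasure (Sym2 (Fin n)) q
      ≤ n * ((1 + 4 * k) ^ (4 * k) * (n * (q * (1 - q) : ℝ)) ^ (2 * k)) := by
  rw [integral_finsetSum _ fun _ _ => .of_finite]
  refine (Finset.sum_le_card_nsmul _ _ _ fun i _ => (le_abs_self _).trans
    (abs_integral_centeredMat_pow_mulVec_pow_le q (by simpa using hd) (by simp) k 4 i)).trans_eq ?_
  have : 4 * k / 2 = 2 * k := by omega
  simp [this]

theorem integral_sum_sq_centeredMat_pow_le (hd : 1 ≤ n * (q * (1 - q) : ℝ)) (k : ℕ) :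
    ∫ x, ∑ i, ∑ j, (centeredMat q x ^ k) i j ^ 2 ∂cubeMeasure (Sym2 (Fin n)) q
      ≤ n ^ 2 * ((1 + 2 * k) ^ (2 * k) * (n * (q * (1 - q) : ℝ)) ^ k) := by
  have hentry (i j : Fin n) : ∫ x, (centeredMat q x ^ k) i j ^ 2 ∂cubeMeasure (Sym2 (Fin n)) q
      ≤ (1 + 2 * k) ^ (2 * k) * (n * (q * (1 - q) : ℝ)) ^ k := by
    have h := (le_abs_self _).trans (abs_integral_centeredMat_pow_mulVec_pow_le q
      (by simpa using hd) (u := Pi.single j 1) (fun l => by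
        rw [Pi.single_apply]
        split_ifs <;> simp) k 2 i)
    simpa using h
  rw [integral_finsetSum _ fun _ _ => .of_finite]
  simp_rw [integral_finsetSum (Finset.univ : Finset (Fin n)) fun _ _ => Integrable.of_finite]
  refine (Finset.sum_le_sum fun i _ => Finset.sum_le_sum fun j _ => hentry i j).trans_eq ?_
  simp
  ring

theorem integral_iterateBound_le (hδ : 1 ≤ δ) (hd : δ ^ 4 = n * (q * (1 - q) : ℝ)) {N : ℕ}
    (hN : n ≤ δ ^ (4 * N)) (hn : 0 < n) :
    ∫ x, iterateBound N δ q x ∂cubeMeasure (Sym2 (Fin n)) q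
      ≤ 8 * (N ^ 3 * ∑ k ∈ Finset.range N, 16 ^ (k + 1) * (1 + 4 * k : ℝ) ^ (4 * k) + 16 ^ N)
        / n := by
  have hd1 : 1 ≤ n * (q * (1 - q) : ℝ) := hd ▸ one_le_pow₀ hδ
  have : (0 : ℝ) < n := by positivity
  have hterm (k : ℕ) : 16 ^ (k + 1) / ((n : ℝ) ^ 2 * (δ ^ 4) ^ (4 * k)) *
      ∫ x, ∑ i, (centeredMat q x ^ k *ᵥ 1) i ^ 4 ∂cubeMeasure (Sym2 (Fin n)) q
        ≤ 16 ^ (k + 1) * (1 + 4 * k) ^ (4 * k) / n := by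
    calc _ ≤ 16 ^ (k + 1) / ((n : ℝ) ^ 2 * (δ ^ 4) ^ (4 * k)) *
            (n * ((1 + 4 * k) ^ (4 * k) * (δ ^ 4) ^ (2 * k))) := by
          gcongr
          exact hd ▸ integral_sum_centeredMat_pow_mulVec_pow_four_le hd1 k
      _ = 16 ^ (k + 1) * (1 + 4 * k) ^ (4 * k) / n / (δ ^ 4) ^ (2 * k) := by
          rw [show 4 * k = 2 * k + 2 * k by ring, pow_add (δ ^ 4)]
          field_simp
      _ ≤ 16 ^ (k + 1) * (1 + 4 * k) ^ (4 * k) / n :=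
          div_le_self (by positivity) (one_le_pow₀ (one_le_pow₀ hδ))
  simp only [iterateBound]
  rw [integral_const_mul, integral_add .of_finite .of_finite, integral_const_mul,
    integral_finsetSum _ fun _ _ => .of_finite]
  simp only [integral_const_mul, integral_const, probReal_univ, one_smul]
  rw [mul_div_assoc, add_div, mul_div_assoc, Finset.sum_div]
  gcongr with k
  exact hterm k

theorem integral_sum_sq_centeredMat_pow_div_le (hδ : 1 ≤ δ) (hd : δ ^ 4 = n * (q * (1 - q) : ℝ))
    {k : ℕ} (hk : (n : ℝ) ^ 3 ≤ δ ^ (2 * k)) (hn : 0 < n) :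
    (∫ x, ∑ i, ∑ j, (centeredMat q x ^ k) i j ^ 2 ∂cubeMeasure (Sym2 (Fin n)) q) / (δ ^ 6) ^ k
      ≤ (1 + 2 * k) ^ (2 * k) / n := by
  have hn0 : (0 : ℝ) < n := by positivity
  rw [div_le_div_iff₀ (by positivity) hn0]
  calc (∫ x, ∑ i, ∑ j, (centeredMat q x ^ k) i j ^ 2 ∂cubeMeasure (Sym2 (Fin n)) q) * n
      ≤ n ^ 2 * ((1 + 2 * k) ^ (2 * k) * (δ ^ 4) ^ k) * n := by
        gcongr
        rw [hd]
        exact integral_sum_sq_centeredMat_pow_le (hd ▸ one_le_pow₀ hδ) k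
    _ = (1 + 2 * k) ^ (2 * k) * ((n : ℝ) ^ 3 * (δ ^ 4) ^ k) := by ring
    _ ≤ (1 + 2 * k) ^ (2 * k) * (δ ^ (2 * k) * (δ ^ 4) ^ k) := by gcongr
    _ = (1 + 2 * k) ^ (2 * k) * (δ ^ 6) ^ k := by
        rw [← pow_mul, ← pow_mul, ← pow_add]
        ring_nf

theorem exists_variance_eigDev_le (N m : ℕ) :
    ∃ C : ℝ, ∀ {n : ℕ} {q : unitInterval} {δ : ℝ}, 0 < n → 2 ≤ δ →
      δ ^ 4 = n * (q * (1 - q) : ℝ) → n ≤ δ ^ (4 * N) → (n : ℝ) ^ 3 ≤ δ ^ (2 * 2 ^ m) →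
      Var[eigDev (n := n); cubeMeasure (Sym2 (Fin n)) q] ≤ C * δ ^ 3 / n := by
  set C₁ : ℝ :=
    8 * (N ^ 3 * ∑ k ∈ Finset.range N, 16 ^ (k + 1) * (1 + 4 * k : ℝ) ^ (4 * k) + 16 ^ N)
  set C₂ : ℝ := (1 + 2 * (2 ^ m : ℕ)) ^ (2 * 2 ^ m)
  refine ⟨2 * (C₁ + 2 + 3 * C₂), fun {n q δ} hn hδ hd hN hm => ?_⟩
  have hδ1 : 1 ≤ δ := by linarith
  have hq0 : (0 : ℝ) ≤ q := q.2.1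
  have hq1 : (q : ℝ) ≤ 1 := q.2.2
  have hdq : δ ^ 4 ≤ n * q := by
    rw [hd]
    gcongr
    exact mul_le_of_le_one_right hq0 (by linarith)
  have hpointwise (x : Sym2 (Fin n) → Bool) :
      (1 - 2 * q) * (topVec (adjMat x) ^ 2 ⬝ᵥ centeredMat q x *ᵥ topVec (adjMat x) ^ 2)
        + 2 / n * (topVec (adjMat x) ⬝ᵥ centeredMat q x *ᵥ topVec (adjMat x))
      ≤ δ ^ 3 * (iterateBound N δ q x + 2 / n)
        + 3 / (δ ^ 6) ^ 2 ^ m * ∑ i, ∑ j, (centeredMat q x ^ 2 ^ m) i j ^ 2 := by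
    refine le_trans ?_ (abs_dotProduct_sq_topVec_add_le hn hδ hdq N m x)
    gcongr
    · refine (le_abs_self _).trans ?_
      rw [abs_mul]
      exact mul_le_of_le_one_left (abs_nonneg _) (abs_le.2 ⟨by linarith, by linarith⟩)
    · exact le_abs_self _
  calc Var[eigDev (n := n); cubeMeasure (Sym2 (Fin n)) q]
      ≤ 2 * (δ ^ 3 * (∫ x, iterateBound N δ q x ∂cubeMeasure (Sym2 (Fin n)) q + 2 / n)
          + 3 * ((∫ x, ∑ i, ∑ j, (centeredMat q x ^ 2 ^ m) i j ^ 2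
            ∂cubeMeasure (Sym2 (Fin n)) q) / (δ ^ 6) ^ 2 ^ m)) := by
        refine (variance_eigDev_le_integral hn q).trans ?_
        gcongr
        refine (integral_mono .of_finite .of_finite hpointwise).trans_eq ?_
        rw [integral_add .of_finite .of_finite, integral_const_mul, integral_const_mul,
          integral_add .of_finite .of_finite]
        simp only [integral_const, probReal_univ, one_smul]
        ring
    _ ≤ 2 * (δ ^ 3 * (C₁ / n + 2 / n) + δ ^ 3 * (3 * (C₂ / n))) := by
        have hbulk := integral_iterateBound_le hδ1 hd hN hn
        have htail := integral_sum_sq_centeredMat_pow_div_le hδ1 hd hm hn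
        have hscale : 3 * (C₂ / n) ≤ δ ^ 3 * (3 * (C₂ / n)) :=
          le_mul_of_one_le_left (by positivity) (one_le_pow₀ hδ1)
        refine mul_le_mul_of_nonneg_left (add_le_add ?_ ?_) zero_le_two
        · gcongr
        · exact (mul_le_mul_of_nonneg_left htail zero_le_three).trans hscale
    _ = 2 * (C₁ + 2 + 3 * C₂) * δ ^ 3 / n := by ring

end Delocalization

section CharacteristicFunctions

open Complex Topology

theorem norm_prod_sub_prod_le {ι : Type*} (s : Finset ι) {a b : ι → ℂ}
    (ha : ∀ i ∈ s, ‖a i‖ ≤ 1) (hb : ∀ i ∈ s, ‖b i‖ ≤ 1) :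
    ‖∏ i ∈ s, a i - ∏ i ∈ s, b i‖ ≤ ∑ i ∈ s, ‖a i - b i‖ := by
  classical
  induction s using Finset.induction_on with
  | empty => simp
  | insert i s hi ih =>
    rw [Finset.forall_mem_insert] at ha hb
    rw [Finset.prod_insert hi, Finset.prod_insert hi, Finset.sum_insert hi]
    have hprod : ‖∏ j ∈ s, b j‖ ≤ 1 := by
      rw [norm_prod]
      exact Finset.prod_le_one (fun _ _ => norm_nonneg _) hb.2
    calc ‖a i * ∏ j ∈ s, a j - b i * ∏ j ∈ s, b j‖
        = ‖(a i - b i) * ∏ j ∈ s, b j + a i * (∏ j ∈ s, a j - ∏ j ∈ s, b j)‖ := by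
          congr 1
          ring
      _ ≤ ‖a i - b i‖ * ‖∏ j ∈ s, b j‖ + ‖a i‖ * ‖∏ j ∈ s, a j - ∏ j ∈ s, b j‖ := by
          refine (norm_add_le _ _).trans ?_
          rw [norm_mul, norm_mul]
      _ ≤ ‖a i - b i‖ * 1 + 1 * ∑ j ∈ s, ‖a j - b j‖ := by
          gcongr
          · exact ha.1
          · exact ih ha.2 hb.2
      _ = ‖a i - b i‖ + ∑ j ∈ s, ‖a j - b j‖ := by ring

theorem norm_exp_mul_I_sub_le {y : ℝ} (hy : |y| ≤ 1) :
    ‖exp (y * I) - (1 + y * I - (y : ℂ) ^ 2 / 2)‖ ≤ |y| ^ 3 := by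
  have hnorm : ‖(y * I : ℂ)‖ = |y| := by simp
  have htaylor := exp_bound (x := y * I) (by rwa [hnorm]) (n := 3) (by norm_num)
  have hsum : ∑ m ∈ Finset.range 3, (y * I : ℂ) ^ m / (m.factorial : ℂ)
      = 1 + y * I - (y : ℂ) ^ 2 / 2 := by
    simp [Finset.sum_range_succ, mul_pow]
    ring
  rw [hnorm, hsum] at htaylor
  refine htaylor.trans (mul_le_of_le_one_right (by positivity) ?_)
  norm_num [Nat.factorial]

theorem norm_exp_mul_I_sub_exp_mul_I_le (a b : ℝ) : ‖exp (a * I) - exp (b * I)‖ ≤ |a - b| := by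
  have hfactor : exp (a * I) - exp (b * I) = exp (b * I) * (exp (I * ((a - b : ℝ) : ℂ)) - 1) := by
    rw [mul_sub, ← exp_add, mul_one]
    congr 2
    push_cast
    ring
  rw [hfactor, norm_mul, norm_exp_ofReal_mul_I, one_mul]
  exact Real.norm_exp_I_mul_ofReal_sub_one_le

variable {Ω : Type*} [MeasurableSpace Ω] {P : Measure Ω}

theorem charFun_map_real {X : Ω → ℝ} (hX : AEMeasurable X P) (t : ℝ) :
    charFun (P.map X) t = ∫ ω, exp ((t * X ω : ℝ) * I) ∂P := by
  rw [charFun_apply_real, integral_map hX (by fun_prop)]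
  push_cast
  rfl

variable [IsProbabilityMeasure P]

theorem integrable_exp_mul_I {X : Ω → ℝ} (hX : AEMeasurable X P) :
    Integrable (fun ω => exp (X ω * I)) P := by
  refine .of_bound (C := 1) (AEMeasurable.aestronglyMeasurable (by fun_prop)) ?_
  exact ae_of_all _ fun ω => (norm_exp_ofReal_mul_I _).le

theorem integrable_one_add_mul_I_sub_sq_div_two {X : Ω → ℝ} (hX : MemLp X 2 P) :
    Integrable (fun ω => 1 + X ω * I - (X ω : ℂ) ^ 2 / 2) P := by
  have hsq : Integrable (fun ω => (X ω : ℂ) ^ 2) P :=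
    hX.integrable_sq.ofReal.congr (ae_of_all _ fun ω => ofReal_pow (X ω) 2)
  exact ((integrable_const 1).add ((hX.integrable one_le_two).ofReal.mul_const I)).sub
    (hsq.div_const 2)

theorem integral_one_add_mul_I_sub_sq_div_two {X : Ω → ℝ} (hX : MemLp X 2 P) (hmean : P[X] = 0) :
    ∫ ω, (1 + X ω * I - (X ω : ℂ) ^ 2 / 2) ∂P = ((1 - Var[X; P] / 2 : ℝ) : ℂ) := by
  have hlin : Integrable (fun ω => (X ω : ℂ) * I) P := (hX.integrable one_le_two).ofReal.mul_const I
  have hsq : Integrable (fun ω => (X ω : ℂ) ^ 2) P :=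
    hX.integrable_sq.ofReal.congr (ae_of_all _ fun ω => ofReal_pow (X ω) 2)
  have hmoment : ∫ ω, (X ω : ℂ) ^ 2 ∂P = (Var[X; P] : ℂ) := by
    simp only [← ofReal_pow]
    rw [integral_complex_ofReal, variance_of_integral_eq_zero hX.aemeasurable hmean]
  calc ∫ ω, (1 + X ω * I - (X ω : ℂ) ^ 2 / 2) ∂P
      = ∫ ω, (1 + X ω * I) ∂P - ∫ ω, (X ω : ℂ) ^ 2 / 2 ∂P :=
        integral_sub ((integrable_const 1).add hlin) (hsq.div_const 2)
    _ = ∫ _, 1 ∂P + ∫ ω, X ω * I ∂P - ∫ ω, (X ω : ℂ) ^ 2 / 2 ∂P := by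
        rw [integral_add (integrable_const 1) hlin]
    _ = ((1 - Var[X; P] / 2 : ℝ) : ℂ) := by
        rw [integral_mul_const, integral_div, integral_complex_ofReal, hmean, hmoment]
        simp

theorem variance_le_sq_of_abs_le {X : Ω → ℝ} {K : ℝ} (hX : AEMeasurable X P)
    (hbound : ∀ᵐ ω ∂P, |X ω| ≤ K) : Var[X; P] ≤ K ^ 2 := by
  have h := variance_le_sq_of_bounded (a := -K) (b := K)
    (hbound.mono fun ω hω => abs_le.1 hω) hX
  refine h.trans_eq ?_
  ring

theorem norm_charFun_map_sub_one_sub_le {X : Ω → ℝ} {K t : ℝ} (hX : AEMeasurable X P)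
    (hmean : P[X] = 0) (hbound : ∀ᵐ ω ∂P, |X ω| ≤ K) (ht : |t| * K ≤ 1) :
    ‖charFun (P.map X) t - ((1 - t ^ 2 * Var[X; P] / 2 : ℝ) : ℂ)‖ ≤ |t| ^ 3 * (K * Var[X; P]) := by
  have hmem : MemLp X 2 P := .of_bound hX.aestronglyMeasurable K hbound
  have hsq : Integrable (fun ω => X ω ^ 2) P := hmem.integrable_sq
  have htaylor := integral_one_add_mul_I_sub_sq_div_two (hmem.const_mul t)
    (by rw [integral_const_mul, hmean, mul_zero])
  rw [variance_const_mul] at htaylor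
  rw [charFun_map_real hX, ← htaylor,
    ← integral_sub (integrable_exp_mul_I (hX.const_mul t))
      (integrable_one_add_mul_I_sub_sq_div_two (hmem.const_mul t)),
    variance_of_integral_eq_zero hX hmean, ← integral_const_mul, ← integral_const_mul]
  refine norm_integral_le_of_norm_le ((hsq.const_mul _).const_mul _) ?_
  filter_upwards [hbound] with ω hω
  have hsmall : |t * X ω| ≤ 1 := by
    rw [abs_mul]
    exact (mul_le_mul_of_nonneg_left hω (abs_nonneg t)).trans ht
  calc _ ≤ |t * X ω| ^ 3 := norm_exp_mul_I_sub_le hsmall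
    _ = |t| ^ 3 * (|X ω| * X ω ^ 2) := by
        rw [abs_mul, ← sq_abs (X ω)]
        ring
    _ ≤ |t| ^ 3 * (K * X ω ^ 2) := by gcongr

theorem norm_charFun_map_sub_exp_le {X : Ω → ℝ} {K t : ℝ} (hX : AEMeasurable X P)
    (hmean : P[X] = 0) (hbound : ∀ᵐ ω ∂P, |X ω| ≤ K) (ht : |t| * K ≤ 1) :
    ‖charFun (P.map X) t - Real.exp (-(t ^ 2 * Var[X; P] / 2))‖
      ≤ 2 * |t| ^ 3 * K * Var[X; P] := by
  have hV0 := variance_nonneg X P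
  have hVK := variance_le_sq_of_abs_le hX hbound
  obtain ⟨ω, hω⟩ := hbound.exists
  have hK : 0 ≤ K := (abs_nonneg _).trans hω
  set V := Var[X; P]
  set w := t ^ 2 * V / 2 with hw
  have hw0 : 0 ≤ w := by positivity
  have hsq : t ^ 2 * V ≤ |t| * K := by
    calc t ^ 2 * V ≤ |t| ^ 2 * K ^ 2 := by
          rw [sq_abs]
          gcongr
      _ = (|t| * K) * (|t| * K) := by ring
      _ ≤ (|t| * K) * 1 := by gcongr
      _ = |t| * K := mul_one _
  have hexp : ‖((1 - w : ℝ) : ℂ) - Real.exp (-w)‖ ≤ |t| ^ 3 * (K * V) := by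
    have hw1 : |-w| ≤ 1 := by
      rw [abs_neg, abs_of_nonneg hw0]
      linarith
    have h := Real.abs_exp_sub_one_sub_id_le hw1
    rw [← ofReal_sub, norm_real, Real.norm_eq_abs, abs_sub_comm,
      show Real.exp (-w) - (1 - w) = Real.exp (-w) - 1 - -w by ring]
    calc _ ≤ (-w) ^ 2 := h
      _ = |t| ^ 2 * V * (t ^ 2 * V) / 4 := by
          rw [sq_abs, hw]
          ring
      _ ≤ |t| ^ 2 * V * (|t| * K) / 4 := by gcongr
      _ = |t| ^ 3 * (K * V) / 4 := by ring
      _ ≤ |t| ^ 3 * (K * V) := div_le_self (by positivity) (by norm_num)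
  calc ‖charFun (P.map X) t - Real.exp (-w)‖
      ≤ ‖charFun (P.map X) t - (1 - w : ℝ)‖ + ‖((1 - w : ℝ) : ℂ) - Real.exp (-w)‖ :=
        norm_sub_le_norm_sub_add_norm_sub _ _ _
    _ ≤ |t| ^ 3 * (K * V) + |t| ^ 3 * (K * V) :=
        add_le_add (norm_charFun_map_sub_one_sub_le hX hmean hbound ht) hexp
    _ = 2 * |t| ^ 3 * K * V := by ring

theorem norm_charFun_map_sum_sub_exp_le {ι : Type*} [Fintype ι] {X : ι → Ω → ℝ} {K t : ℝ}
    (hindep : iIndepFun X P) (hX : ∀ i, AEMeasurable (X i) P) (hmean : ∀ i, P[X i] = 0)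
    (hbound : ∀ i, ∀ᵐ ω ∂P, |X i ω| ≤ K) (ht : |t| * K ≤ 1) :
    ‖charFun (P.map (∑ i, X i)) t - Real.exp (-(t ^ 2 * Var[∑ i, X i; P] / 2))‖
      ≤ 2 * |t| ^ 3 * K * Var[∑ i, X i; P] := by
  have hvar : Var[∑ i, X i; P] = ∑ i, Var[X i; P] :=
    IndepFun.variance_sum (fun i _ => .of_bound (hX i).aestronglyMeasurable K (hbound i))
      fun i _ j _ hij => hindep.indepFun hij
  rw [hvar, hindep.charFun_map_sum_eq_prod hX, Finset.prod_apply, Finset.mul_sum, Finset.sum_div,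
    ← Finset.sum_neg_distrib, Real.exp_sum, ofReal_prod, Finset.mul_sum]
  refine (norm_prod_sub_prod_le _ (fun i _ => ?_) fun i _ => ?_).trans
    (Finset.sum_le_sum fun i _ => norm_charFun_map_sub_exp_le (hX i) (hmean i) (hbound i) ht)
  · have := Measure.isProbabilityMeasure_map (hX i)
    exact norm_charFun_le_one t
  · have := variance_nonneg (X i) P
    rw [norm_real, Real.norm_of_nonneg (Real.exp_nonneg _), Real.exp_le_one_iff, neg_nonpos]
    positivity

theorem norm_charFun_map_sub_charFun_map_le {X Y : Ω → ℝ} (hX : AEMeasurable X P)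
    (hY : AEMeasurable Y P) (hXY : MemLp (X - Y) 2 P) (t : ℝ) :
    ‖charFun (P.map X) t - charFun (P.map Y) t‖ ≤ |t| * √(∫ ω, (X ω - Y ω) ^ 2 ∂P) := by
  have hL1 : ∫ ω, |X ω - Y ω| ∂P ≤ √(∫ ω, (X ω - Y ω) ^ 2 ∂P) := by
    have hvar := variance_nonneg |X - Y| P
    rw [variance_eq_sub hXY.abs] at hvar
    simp only [Pi.pow_apply, Pi.abs_apply, Pi.sub_apply, sq_abs] at hvar
    exact Real.le_sqrt_of_sq_le (sub_nonneg.1 hvar)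
  rw [charFun_map_real hX, charFun_map_real hY, ← integral_sub
    (integrable_exp_mul_I (hX.const_mul t)) (integrable_exp_mul_I (hY.const_mul t))]
  refine le_trans ?_ (mul_le_mul_of_nonneg_left hL1 (abs_nonneg t))
  rw [← integral_const_mul]
  refine norm_integral_le_of_norm_le ((hXY.integrable one_le_two).abs.const_mul |t|) ?_
  refine ae_of_all _ fun ω => (norm_exp_mul_I_sub_exp_mul_I_le _ _).trans_eq ?_
  rw [← mul_sub, abs_mul]

end CharacteristicFunctions

section ConvergenceInDistribution

open Topology
open scoped NNReal

variable {Ω : ℕ → Type*} [∀ k, MeasurableSpace (Ω k)]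
  {P : ∀ k, Measure (Ω k)} [∀ k, IsProbabilityMeasure (P k)]

theorem tendstoInDistribution_iff_tendsto_charFun {Ω' : Type*} [MeasurableSpace Ω']
    {μ : Measure Ω'} [IsProbabilityMeasure μ] {X : ∀ k, Ω k → ℝ} {Z : Ω' → ℝ}
    (hX : ∀ k, AEMeasurable (X k) (P k)) (hZ : AEMeasurable Z μ) :
    TendstoInDistribution X atTop Z P μ ↔
      ∀ t, Tendsto (fun k => charFun ((P k).map (X k)) t) atTop (𝓝 (charFun (μ.map Z) t)) :=
  ⟨fun h => ProbabilityMeasure.tendsto_iff_tendsto_charFun.1 h.tendsto,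
    fun h => ⟨hX, hZ, ProbabilityMeasure.tendsto_iff_tendsto_charFun.2 h⟩⟩

theorem tendstoInDistribution_sum_gaussianReal {ι : ℕ → Type*} [∀ k, Fintype (ι k)]
    {X : ∀ k, ι k → Ω k → ℝ} {K : ℕ → ℝ} {v : ℝ≥0} (hindep : ∀ k, iIndepFun (X k) (P k))
    (hX : ∀ k i, AEMeasurable (X k i) (P k)) (hmean : ∀ k i, ∫ ω, X k i ω ∂P k = 0)
    (hbound : ∀ k i, ∀ᵐ ω ∂P k, |X k i ω| ≤ K k) (hK : Tendsto K atTop (𝓝 0))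
    (hvar : Tendsto (fun k => Var[∑ i, X k i; P k]) atTop (𝓝 v)) :
    TendstoInDistribution (fun k => ∑ i, X k i) atTop (id : ℝ → ℝ) P (gaussianReal 0 v) := by
  refine (tendstoInDistribution_iff_tendsto_charFun
    (fun k => Finset.aemeasurable_sum _ fun i _ => hX k i) aemeasurable_id).2 fun t => ?_
  have hgauss : charFun ((gaussianReal 0 v).map id) t = Real.exp (-(t ^ 2 * v / 2)) := by
    rw [Measure.map_id, charFun_gaussianReal]
    push_cast
    congr 1
    ring
  have hlimit : Tendsto (fun k => (Real.exp (-(t ^ 2 * Var[∑ i, X k i; P k] / 2)) : ℂ)) atTop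
      (𝓝 (Real.exp (-(t ^ 2 * v / 2)))) :=
    ((Complex.continuous_ofReal.comp Real.continuous_exp).tendsto _).comp
      ((hvar.const_mul _).div_const _).neg
  have herror : Tendsto (fun k => 2 * |t| ^ 3 * K k * Var[∑ i, X k i; P k]) atTop (𝓝 0) := by
    simpa using (hK.const_mul (2 * |t| ^ 3)).mul hvar
  have hsmall : ∀ᶠ k in atTop, |t| * K k ≤ 1 := by
    have h : Tendsto (fun k => |t| * K k) atTop (𝓝 0) := by simpa using hK.const_mul |t|
    exact (h.eventually_lt_const one_pos).mono fun _ => le_of_lt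
  rw [hgauss]
  have hdiff := squeeze_zero_norm' (hsmall.mono fun k hk =>
    norm_charFun_map_sum_sub_exp_le (hindep k) (hX k) (hmean k) (hbound k) hk) herror
  simpa using hdiff.add hlimit

variable {Ω' : Type*} [MeasurableSpace Ω'] {μ : Measure Ω'} [IsProbabilityMeasure μ] {Z : Ω' → ℝ}
  {Y : ∀ k, Ω k → ℝ}

theorem tendstoInDistribution_of_tendsto_integral_sq_sub {X : ∀ k, Ω k → ℝ}
    (hY : TendstoInDistribution Y atTop Z P μ) (hX : ∀ k, AEMeasurable (X k) (P k))
    (hXY : ∀ k, MemLp (X k - Y k) 2 (P k))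
    (hlim : Tendsto (fun k => ∫ ω, (X k ω - Y k ω) ^ 2 ∂P k) atTop (𝓝 0)) :
    TendstoInDistribution X atTop Z P μ := by
  have hYm := hY.forall_aemeasurable
  have hZm := hY.aemeasurable_limit
  refine (tendstoInDistribution_iff_tendsto_charFun hX hZm).2 fun t => ?_
  have herror : Tendsto (fun k => |t| * √(∫ ω, (X k ω - Y k ω) ^ 2 ∂P k)) atTop (𝓝 0) := by
    simpa using hlim.sqrt.const_mul |t|
  have hdiff := squeeze_zero_norm
    (fun k => norm_charFun_map_sub_charFun_map_le (hX k) (hYm k) (hXY k) t) herror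
  simpa using hdiff.add ((tendstoInDistribution_iff_tendsto_charFun hYm hZm).1 hY t)

theorem tendstoInDistribution_of_forall_identDistrib {Ω₁ : ℕ → Type*} [∀ k, MeasurableSpace (Ω₁ k)]
    {P₁ : ∀ k, Measure (Ω₁ k)} [∀ k, IsProbabilityMeasure (P₁ k)] {X : ∀ k, Ω₁ k → ℝ}
    (hY : TendstoInDistribution Y atTop Z P μ) (hXY : ∀ k, IdentDistrib (X k) (Y k) (P₁ k) (P k)) :
    TendstoInDistribution X atTop Z P₁ μ where
  forall_aemeasurable k := (hXY k).aemeasurable_fst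
  aemeasurable_limit := hY.aemeasurable_limit
  tendsto := by
    refine hY.tendsto.congr fun k => Subtype.ext (hXY k).map_eq.symm

end ConvergenceInDistribution

section Law

variable {n : ℕ}

open Classical in
/-- The bits encoding a symmetric `0`-`1` matrix, the inverse of `adjMat`. -/
noncomputable def entryBits (M : Matrix (Fin n) (Fin n) ℝ) (e : Sym2 (Fin n)) : Bool :=
  decide (M e.inf e.sup = 1)

theorem adjMat_entryBits {M : Matrix (Fin n) (Fin n) ℝ} (hM : M.IsSymm)
    (h01 : ∀ e : Sym2 (Fin n), M e.inf e.sup = 1 ∨ M e.inf e.sup = 0) :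
    adjMat (entryBits M) = M := by
  ext i j
  have hentry : M i j = M s(i, j).inf s(i, j).sup := by
    rcases le_total i j with hij | hij
    · simp [hij]
    · simp [hij, hM.apply j i]
  rcases h01 s(i, j) with h | h <;>
    simp [hentry, adjMat, entryBits, -Sym2.inf_mk, -Sym2.sup_mk, h]

namespace IsSymmetricBernoulliMatrix

variable {Ω : Type*} [MeasurableSpace Ω] {P : Measure Ω} {q : unitInterval}
  {A : Ω → Matrix (Fin n) (Fin n) ℝ}

theorem ae_adjMat_entryBits_eq (hA : IsSymmetricBernoulliMatrix P q A) :
    ∀ᵐ ω ∂P, adjMat (entryBits (A ω)) = A ω := by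
  have h01 : ∀ᵐ ω ∂P, ∀ e : Sym2 (Fin n), A ω e.inf e.sup = 1 ∨ A ω e.inf e.sup = 0 := by
    refine ae_all_iff.2 fun e => ?_
    have hmeas : Measurable fun a : ℝ => a = 1 ∨ a = 0 :=
      measurableSet_setOfPred.1 ((measurableSet_singleton 1).union (measurableSet_singleton 0))
    refine ((hA.bernoulli e.inf e.sup e.inf_le_sup).ae_iff hmeas).2 ?_
    exact bernoulliMeasure_apply_of_notMem_of_notMem q
      (measurableSet_setOfPred.2 hmeas).compl (by simp) (by simp)
  filter_upwards [h01] with ω hω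
  exact adjMat_entryBits (hA.symm ω) hω

theorem hasLaw_entryBits (hA : IsSymmetricBernoulliMatrix P q A) :
    HasLaw (fun ω => entryBits (A ω)) (cubeMeasure (Sym2 (Fin n)) q) P := by
  classical
  have hbit : Measurable fun a : ℝ => decide (a = 1) :=
    measurable_to_bool (by simp [Set.preimage])
  refine iIndepFun.hasLaw_pi (fun e => ?_) ?_
  · refine HasLaw.comp (μ := bernoulliMeasure (1 : ℝ) 0 q) (Y := fun a : ℝ => decide (a = 1))
      ⟨hbit.aemeasurable, ?_⟩ (hA.bernoulli e.inf e.sup e.inf_le_sup)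
    simp [map_bernoulliMeasure' _ _ hbit]
  · exact (hA.indep.precomp Sym2.sortEquiv.injective).comp _ fun _ => hbit

theorem identDistrib_adjMat (hA : IsSymmetricBernoulliMatrix P q A) {β : Type*} [MeasurableSpace β]
    (F : Matrix (Fin n) (Fin n) ℝ → β) :
    IdentDistrib (fun ω => F (A ω)) (fun x => F (adjMat x)) P (cubeMeasure (Sym2 (Fin n)) q) := by
  have hbits : IdentDistrib (fun ω => entryBits (A ω)) id P (cubeMeasure (Sym2 (Fin n)) q) :=
    hA.hasLaw_entryBits.identDistrib .id
  have hF : Measurable fun x : Sym2 (Fin n) → Bool => F (adjMat x) := .of_discrete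
  have heq : (fun ω => F (adjMat (entryBits (A ω)))) =ᵐ[P] fun ω => F (A ω) :=
    hA.ae_adjMat_entryBits_eq.mono fun _ h => congrArg F h
  exact (IdentDistrib.of_ae_eq (hbits.comp hF).aemeasurable_fst heq).symm.trans (hbits.comp hF)

end IsSymmetricBernoulliMatrix

end Law

section Growth

theorem eventually_pow_le_pow {δ : ℕ → ℝ} {ε : ℝ} (hδ : ∀ᶠ n : ℕ in atTop, (n : ℝ) ^ ε ≤ δ n)
    {a k : ℕ} (hak : a ≤ ε * k) : ∀ᶠ n : ℕ in atTop, (n : ℝ) ^ a ≤ δ n ^ k := by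
  filter_upwards [hδ, eventually_ge_atTop 1] with n hn hn1
  calc (n : ℝ) ^ a = (n : ℝ) ^ (a : ℝ) := (Real.rpow_natCast _ _).symm
    _ ≤ (n : ℝ) ^ (ε * k) := Real.rpow_le_rpow_of_exponent_le (Nat.one_le_cast.2 hn1) hak
    _ = ((n : ℝ) ^ ε) ^ k := Real.rpow_mul_natCast n.cast_nonneg _ _
    _ ≤ δ n ^ k := by gcongr

theorem eventually_rpow_add_le_pow_succ_mul {v : ℕ → ℝ} {ε : ℝ}
    (hv : ∀ᶠ n : ℕ in atTop, (n : ℝ) ^ (ε - 1) ≤ v n) (k : ℕ) :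
    ∀ᶠ n : ℕ in atTop, (n : ℝ) ^ (ε + k) ≤ (n : ℝ) ^ (k + 1) * v n := by
  filter_upwards [hv, eventually_gt_atTop 0] with n hn hn0
  have hpos : (0 : ℝ) < n := Nat.cast_pos.2 hn0
  calc (n : ℝ) ^ (ε + k) = (n : ℝ) ^ (k + 1) * (n : ℝ) ^ (ε - 1) := by
        rw [← Real.rpow_natCast, ← Real.rpow_add hpos]
        push_cast
        ring_nf
    _ ≤ (n : ℝ) ^ (k + 1) * v n := by gcongr

theorem exists_tendsto_atTop_pow_four_eq {v : ℕ → ℝ} {ε : ℝ} (hv0 : ∀ n, 0 ≤ v n) (hε : 0 < ε)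
    (hv : ∀ᶠ n : ℕ in atTop, (n : ℝ) ^ (ε - 1) ≤ v n) :
    ∃ (δ : ℕ → ℝ) (N m : ℕ), Tendsto δ atTop atTop ∧ (∀ n, δ n ^ 4 = n * v n) ∧
      ∀ᶠ n : ℕ in atTop, n ≤ δ n ^ (4 * N) ∧ (n : ℝ) ^ 3 ≤ δ n ^ (2 * 2 ^ m) := by
  set δ : ℕ → ℝ := fun n => (n * v n) ^ (1 / 4 : ℝ)
  have hδge : ∀ᶠ n : ℕ in atTop, (n : ℝ) ^ (ε / 4) ≤ δ n := by
    filter_upwards [eventually_rpow_add_le_pow_succ_mul hv 0] with n hn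
    rw [Nat.cast_zero, add_zero, zero_add, pow_one] at hn
    rw [div_eq_mul_one_div, Real.rpow_mul n.cast_nonneg]
    exact Real.rpow_le_rpow (by positivity) hn (by norm_num)
  obtain ⟨N, hN⟩ := exists_nat_ge (1 / ε)
  obtain ⟨m, hm⟩ := pow_unbounded_of_one_lt (6 / ε) one_lt_two
  rw [div_le_iff₀ hε] at hN
  rw [div_lt_iff₀ hε] at hm
  refine ⟨δ, N, m, tendsto_atTop_mono' _ hδge ?_, fun n => ?_, ?_⟩
  · exact (tendsto_rpow_atTop (by positivity)).comp tendsto_natCast_atTop_atTop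
  · rw [← Real.rpow_mul_natCast (mul_nonneg n.cast_nonneg (hv0 n))]
    norm_num
  · have hpowN := eventually_pow_le_pow hδge (a := 1) (k := 4 * N) (by push_cast; linarith)
    have hpowm := eventually_pow_le_pow hδge (a := 3) (k := 2 * 2 ^ m) (by push_cast; linarith)
    simpa only [pow_one] using hpowN.and hpowm

theorem eventually_rpow_sub_one_le_mul_one_sub {p : ℕ → ℝ} {ε : ℝ} (hε : 0 < ε)
    (hp : ∀ᶠ n : ℕ in atTop, (n : ℝ) ^ (ε - 1) ≤ p n ∧ p n ≤ 1 / 2) :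
    ∀ᶠ n : ℕ in atTop, (n : ℝ) ^ (ε / 2 - 1) ≤ p n * (1 - p n) := by
  have hlarge : ∀ᶠ n : ℕ in atTop, 2 ≤ (n : ℝ) ^ (ε / 2) :=
    ((tendsto_rpow_atTop (half_pos hε)).comp tendsto_natCast_atTop_atTop).eventually_ge_atTop 2
  filter_upwards [hp, hlarge, eventually_gt_atTop 0] with n ⟨hlow, hhalf⟩ hn2 hn
  have hpos : (0 : ℝ) < n := Nat.cast_pos.2 hn
  calc (n : ℝ) ^ (ε / 2 - 1) = 2 * (n : ℝ) ^ (ε / 2 - 1) * (1 / 2) := by ring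
    _ ≤ (n : ℝ) ^ (ε / 2) * (n : ℝ) ^ (ε / 2 - 1) * (1 / 2) := by gcongr
    _ = (n : ℝ) ^ (ε - 1) * (1 / 2) := by
        rw [← Real.rpow_add hpos]
        ring_nf
    _ ≤ p n * (1 - p n) :=
        mul_le_mul hlow (by linarith) (by norm_num) (hlow.trans' (by positivity))

end Growth

section Fluctuations

open Matrix Topology
open scoped NNReal

variable {n : ℕ}

theorem meanDegree_sub_eq_sum (q : unitInterval) (x : Sym2 (Fin n) → Bool) :
    meanDegree x - n * q = ∑ e, edgeMult e / n * centeredBit q (x e) := by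
  obtain rfl | hn := n.eq_zero_or_pos
  · simp [meanDegree]
  · have hsum : 1 ⬝ᵥ centeredMat q x *ᵥ 1 = ∑ e, edgeMult e * centeredBit q (x e) := by
      rw [← sum_sum_sym2, dotProduct_mulVec_eq_sum]
      simp [centeredMat]
    rw [meanDegree_eq hn q, hsum, add_sub_cancel_left, Finset.sum_div]
    exact Finset.sum_congr rfl fun e _ => mul_div_right_comm _ _ _

theorem integral_meanDegree (q : unitInterval) :
    ∫ x, meanDegree x ∂cubeMeasure (Sym2 (Fin n)) q = n * q := by
  have hzero : ∫ x, (meanDegree x - n * q) ∂cubeMeasure (Sym2 (Fin n)) q = 0 := by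
    simp_rw [meanDegree_sub_eq_sum q]
    rw [integral_finsetSum _ fun _ _ => .of_finite]
    exact Finset.sum_eq_zero fun e _ => by
      rw [integral_const_mul, integral_centeredBit_eval, mul_zero]
  rw [integral_sub .of_finite (integrable_const _)] at hzero
  simpa [sub_eq_zero] using hzero

theorem variance_meanDegree (hn : 0 < n) (q : unitInterval) :
    Var[meanDegree; cubeMeasure (Sym2 (Fin n)) q] = (q * (1 - q)) * (2 - 1 / n : ℝ) := by
  have hbit (e : Sym2 (Fin n)) :
      Var[fun b => edgeMult e / n * centeredBit q b; bernoulliMeasure true false q]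
        = q * (1 - q) / n ^ 2 * edgeMult e ^ 2 := by
    rw [variance_bernoulliMeasure_bool]
    simp only [centeredBit, if_true, Bool.false_eq_true, if_false]
    ring
  rw [← variance_sub_const .of_discrete (n * q : ℝ)]
  simp_rw [meanDegree_sub_eq_sum q]
  have hsum := variance_sum_pi (μ := fun _ : Sym2 (Fin n) => bernoulliMeasure true false q)
    (X := fun e b => edgeMult e / n * centeredBit q b) fun _ => .of_discrete
  simp only [Finset.sum_fn, hbit] at hsum
  rw [hsum, ← Finset.mul_sum, sum_edgeMult_sq, Fintype.card_fin]
  field_simp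

theorem tendsto_variance_meanDegree_div {p : ℕ → unitInterval}
    (hp : Tendsto (fun n : ℕ => (n : ℝ) ^ 2 * (p n * (1 - p n))) atTop atTop) :
    Tendsto (fun n => Var[meanDegree; cubeMeasure (Sym2 (Fin n)) (p n)] / (p n * (1 - p n) : ℝ))
      atTop (𝓝 2) := by
  have hlim : Tendsto (fun n : ℕ => 2 - 1 / (n : ℝ)) atTop (𝓝 2) := by
    simpa using tendsto_one_div_atTop_nhds_zero_nat.const_sub (2 : ℝ)
  refine hlim.congr' ?_
  filter_upwards [hp.eventually_gt_atTop 0, eventually_gt_atTop 0] with n hpos hn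
  have hv : 0 < (p n * (1 - p n) : ℝ) := pos_of_mul_pos_right hpos (sq_nonneg _)
  rw [variance_meanDegree hn, mul_div_cancel_left₀ _ hv.ne']

theorem tendstoInDistribution_meanDegree {p : ℕ → unitInterval}
    (hp : Tendsto (fun n : ℕ => (n : ℝ) ^ 2 * (p n * (1 - p n))) atTop atTop) :
    TendstoInDistribution (fun n (x : Sym2 (Fin n) → Bool) =>
        1 / √(p n * (1 - p n) : ℝ) * (meanDegree x - n * p n))
      atTop (id : ℝ → ℝ) (fun n => cubeMeasure (Sym2 (Fin n)) (p n)) (gaussianReal 0 2) := by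
  set X : ∀ n, Sym2 (Fin n) → (Sym2 (Fin n) → Bool) → ℝ := fun n e x =>
    1 / √(p n * (1 - p n) : ℝ) * (edgeMult e / n * centeredBit (p n) (x e))
  have hsum (n : ℕ) : ∑ e, X n e =
      fun x => 1 / √(p n * (1 - p n) : ℝ) * (meanDegree x - n * p n) := by
    ext x
    rw [meanDegree_sub_eq_sum, Finset.mul_sum, Finset.sum_apply]
  have hscale : Tendsto (fun n : ℕ => n * √(p n * (1 - p n) : ℝ)) atTop atTop := by
    refine (Real.tendsto_sqrt_atTop.comp hp).congr fun n => ?_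
    rw [Function.comp_apply, Real.sqrt_mul (sq_nonneg _), Real.sqrt_sq n.cast_nonneg]
  have hvar : Tendsto (fun n => Var[∑ e, X n e; cubeMeasure (Sym2 (Fin n)) (p n)]) atTop
      (𝓝 (2 : ℝ≥0)) := by
    refine (tendsto_variance_meanDegree_div hp).congr fun n => ?_
    have hv : 0 ≤ (p n * (1 - p n) : ℝ) := mul_one_sub_nonneg (p n)
    rw [hsum, variance_const_mul, variance_sub_const .of_discrete, div_pow, Real.sq_sqrt hv,
      one_pow, one_div_mul_eq_div]
  have hclt := tendstoInDistribution_sum_gaussianReal (X := X)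
    (P := fun n => cubeMeasure (Sym2 (Fin n)) (p n))
    (K := fun n => 2 / (n * √(p n * (1 - p n) : ℝ)))
    (fun n => ?_) (fun n e => .of_discrete) (fun n e => ?_) (fun n e => ae_of_all _ fun x => ?_)
    (hscale.const_div_atTop 2) hvar
  · simpa only [hsum] using hclt
  · exact iIndepFun_pi (X := fun e b => 1 / √(p n * (1 - p n) : ℝ) * (edgeMult e / n *
      centeredBit (p n) b)) fun _ => .of_discrete
  · rw [integral_const_mul, integral_const_mul, integral_centeredBit_eval, mul_zero, mul_zero]
  · have hscalar : 0 ≤ 1 / √(p n * (1 - p n) : ℝ) * (edgeMult e / n) :=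
      mul_nonneg (by positivity) (div_nonneg (edgeMult_nonneg e) n.cast_nonneg)
    calc |X n e x| = 1 / √(p n * (1 - p n) : ℝ) * (edgeMult e / n) * |centeredBit (p n) (x e)| := by
          simp only [X]
          rw [← mul_assoc, abs_mul, abs_of_nonneg hscalar]
      _ ≤ 1 / √(p n * (1 - p n) : ℝ) * (2 / n) * 1 := by
          gcongr
          exacts [edgeMult_le_two e, abs_centeredBit_le_one _ _]
      _ = 2 / (n * √(p n * (1 - p n) : ℝ)) := by
          rw [mul_one, div_mul_div_comm, one_mul, mul_comm]

theorem tendsto_variance_eigDev_div {p : ℕ → unitInterval} {ε : ℝ} (hε : 0 < ε)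
    (hp : ∀ᶠ n : ℕ in atTop, (n : ℝ) ^ (ε - 1) ≤ p n * (1 - p n)) :
    Tendsto (fun n => Var[eigDev; cubeMeasure (Sym2 (Fin n)) (p n)] / (p n * (1 - p n) : ℝ))
      atTop (𝓝 0) := by
  have hv (n : ℕ) : 0 ≤ (p n * (1 - p n) : ℝ) := mul_one_sub_nonneg (p n)
  obtain ⟨δ, N, m, hδtop, hδ4, hpow⟩ := exists_tendsto_atTop_pow_four_eq hv hε hp
  obtain ⟨C, hC⟩ := exists_variance_eigDev_le N m
  refine squeeze_zero' (.of_forall fun n => div_nonneg (variance_nonneg _ _) (hv n)) ?_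
    (hδtop.const_div_atTop C)
  filter_upwards [hpow, hδtop.eventually_ge_atTop 2, eventually_gt_atTop 0]
    with n ⟨hnN, hnm⟩ hn2 hn
  calc _ ≤ C * δ n ^ 3 / n / (p n * (1 - p n)) :=
        div_le_div_of_nonneg_right (hC hn hn2 (hδ4 n) hnN hnm) (hv n)
    _ = C / δ n := by
        rw [div_div, ← hδ4]
        field_simp

theorem tendstoInDistribution_largestEigenvalue_adjMat {p : ℕ → unitInterval} {ε : ℝ} (hε : 0 < ε)
    (hp : ∀ᶠ n : ℕ in atTop, (n : ℝ) ^ (ε - 1) ≤ p n * (1 - p n)) :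
    TendstoInDistribution (fun n (x : Sym2 (Fin n) → Bool) => 1 / √(p n * (1 - p n) : ℝ) *
        (largestEigenvalue (adjMat x) -
          ∫ y, largestEigenvalue (adjMat y) ∂cubeMeasure (Sym2 (Fin n)) (p n)))
      atTop (id : ℝ → ℝ) (fun n => cubeMeasure (Sym2 (Fin n)) (p n)) (gaussianReal 0 2) := by
  have hgrowth : Tendsto (fun n : ℕ => (n : ℝ) ^ 2 * (p n * (1 - p n))) atTop atTop :=
    tendsto_atTop_mono' _ (eventually_rpow_add_le_pow_succ_mul hp 1)
      ((tendsto_rpow_atTop (by positivity)).comp tendsto_natCast_atTop_atTop)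
  refine tendstoInDistribution_of_tendsto_integral_sq_sub
    (tendstoInDistribution_meanDegree hgrowth) (fun n => .of_discrete) (fun n => .of_discrete)
    ((tendsto_variance_eigDev_div hε hp).congr fun n => ?_)
  have hv : 0 ≤ (p n * (1 - p n) : ℝ) := mul_one_sub_nonneg (p n)
  have hmean : ∫ y, eigDev y ∂cubeMeasure (Sym2 (Fin n)) (p n) =
      ∫ y, largestEigenvalue (adjMat y) ∂cubeMeasure (Sym2 (Fin n)) (p n) - n * p n := by
    rw [← integral_meanDegree, ← integral_sub .of_finite .of_finite]
    rfl
  rw [variance_eq_integral .of_discrete, hmean, ← integral_div]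
  congr with x
  rw [← mul_sub, mul_pow, div_pow, Real.sq_sqrt hv, eigDev]
  ring

end Fluctuations

theorem theorem2_general {Ω : ℕ → Type*} [∀ n, MeasurableSpace (Ω n)]
    (P : ∀ n, Measure (Ω n)) [∀ n, IsProbabilityMeasure (P n)]
    (p : ℕ → unitInterval) (A : ∀ n, Ω n → Matrix (Fin n) (Fin n) ℝ)
    (hA : ∀ n, IsSymmetricBernoulliMatrix (P n) (p n) (A n)) (ε : ℝ) (hε : 0 < ε)
    (hp : ∀ᶠ n : ℕ in atTop, (n : ℝ) ^ (ε - 1) ≤ (p n : ℝ) * (1 - (p n : ℝ))) :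
    (∀ n, Integrable (fun ω => largestEigenvalue (A n ω)) (P n)) ∧
    TendstoInDistribution
      (fun (n : ℕ) (ω : Ω n) =>
        (1 / Real.sqrt ((p n : ℝ) * (1 - (p n : ℝ)))) *
          (largestEigenvalue (A n ω) - ∫ ω', largestEigenvalue (A n ω') ∂(P n)))
      atTop (id : ℝ → ℝ) P (gaussianReal 0 2) := by
  have hlaw (n : ℕ) := (hA n).identDistrib_adjMat largestEigenvalue
  refine ⟨fun n => (hlaw n).integrable_iff.2 .of_finite, ?_⟩
  simp only [(hlaw _).integral_eq]
  exact tendstoInDistribution_of_forall_identDistrib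
    (tendstoInDistribution_largestEigenvalue_adjMat hε hp)
    fun n => ((hlaw n).sub_const _).const_mul _

theorem theorem2 {Ω : ℕ → Type*} [∀ n, MeasurableSpace (Ω n)]
    (P : ∀ n, Measure (Ω n)) [∀ n, IsProbabilityMeasure (P n)]
    (p : ℕ → unitInterval) (A : ∀ n, Ω n → Matrix (Fin n) (Fin n) ℝ)
    (hA : ∀ n, IsSymmetricBernoulliMatrix (P n) (p n) (A n))
    (ε₀ : ℝ) (hε₀ : ε₀ ∈ Set.Ioo (0 : ℝ) 1)
    (hp : ∀ᶠ n : ℕ in atTop, (n : ℝ) ^ (ε₀ - 1) ≤ (p n : ℝ) ∧ (p n : ℝ) ≤ 1 / 2) :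
    (∀ n, Integrable (fun ω => largestEigenvalue (A n ω)) (P n)) ∧
    TendstoInDistribution
      (fun (n : ℕ) (ω : Ω n) =>
        (1 / Real.sqrt ((p n : ℝ) * (1 - (p n : ℝ)))) *
          (largestEigenvalue (A n ω) - ∫ ω', largestEigenvalue (A n ω') ∂(P n)))
      atTop (id : ℝ → ℝ) P (gaussianReal 0 2) :=
  theorem2_general P p A hA (ε₀ / 2) (half_pos hε₀.1)
    (eventually_rpow_sub_one_le_mul_one_sub hε₀.1 hp)
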